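/- Use the Fourier transform $\hat g(\xi)=(2\pi)^{-1/2}\int_{\mathbb R}g(x)e^{-ix\xi}\,dx$ on $L^1(\mathbb R)$ and its Plancherel extension to $L^2(\mathbb R)$. For $f\in L^2(\mathbb R)$ (complex valued) let $$\|f\|_{(PW,l^1)}=\sum_{m\in\mathbb Z}\|\hat f(\cdot+2\pi m)\|_{L^2([-\pi,\pi])}\in[0,\infty],$$ and let $(PW,l^1)$ be the set of $f\in L^2(\mathbb R)$ with $\|f\|_{(PW,l^1)}<\infty$. A sequence $(x_n)_{n\in\mathbb Z}$ of real numbers is a complete interpolating sequence for $L^2([-\pi,\pi])$ if the exponentials $e^{-ix_n\xi}$, $n\in\mathbb Z$, form a Riesz basis of $L^2([-\pi,\pi])$. A function $\phi:\mathbb R\to\mathbb R$ is an interpolator for $PW_\pi$ if $\phi\in L^1(\mathbb R)\cap C(\mathbb R)$, $\hat\phi\in L^1(\mathbb R)$, $\hat\phi\ge 0$ on $\mathbb R$, $\hat\phi\ge\delta$ on $[-\pi,\pi]$ for some $\delta>0$, and $\sum_{j\in\mathbb Z}M_j<\infty$, where $M_j=\sup_{|\xi|\le\pi}\hat\phi(\xi+2\pi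 j)$. For $A\subset(0,\infty)$, a family $\{\phi_\alpha:\alpha\in A\}$ is a regular family of interpolators if every $\phi_\alpha$ is an interpolator for $PW_\pi$ and, with $M_j(\alpha)$ the numbers $M_j$ of $\phi_\alpha$ and $m_\alpha=\inf_{|\xi|\le\pi}\hat\phi_\alpha(\xi)$, there is a constant $C$ independent of $\alpha$ with $\sum_{j\ne0}M_j(\alpha)\le C\,m_\alpha$ for all $\alpha\in A$, and $\lim_{\alpha\to\infty}m_\alpha/\hat\phi_\alpha(\xi)=0$ for almost every $|\xi|\le\pi$. Limits $\alpha\to\infty$ are taken along $\alpha\in A$. **Theorem.** Let $f\in(PW,l^1)$, let $(x_n)_{n\in\mathbb Z}$ be a complete interpolating sequence for $L^2([-\pi,\pi])$, and let $\{\phi_\alpha:\alpha\in A\}$ be a regular family of interpolators. For $m\in\mathbb Z$ let $$g_m(x)=(2\pi)^{-1/2}\int_{-\pi}^{\pi}\hat f(\xi+2\pi m)\,e^{ix\xi}\,d\xi ,$$ that is, $g_m\in PW_\pi$ has Fourier transform $\hat f(\xi+2\pi m)\chi_{[-\pi,\pi]}(\xi)$. Then for all $\alpha\in A$ and $m\in\mathbb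 Z$ there is a unique sequence $(a_{m,n}(\alpha))_{n\in\mathbb Z}\in\ell^2(\mathbb Z)$ such that $$I_\alpha g_m(x)=\sum_{n\in\mathbb Z}a_{m,n}(\alpha)\,\phi_\alpha(x-x_n)$$ satisfies $I_\alpha g_m(x_k)=g_m(x_k)$ for all $k\in\mathbb Z$. The series for $I_\alpha g_m(x)$ and the series $$J_\alpha f(x)=\sum_{m\in\mathbb Z}e^{2\pi imx}I_\alpha g_m(x)$$ converge absolutely for every $x\in\mathbb R$, $J_\alpha f$ belongs to $(PW,l^1)$, and A. $\displaystyle\lim_{\alpha\to\infty}\|f-J_\alpha f\|_{L^2(\mathbb R)}=0$; B. $\displaystyle\lim_{\alpha\to\infty}\|f-J_\alpha f\|_{(PW,l^1)}=0$; C. $f$ agrees almost everywhere with a continuous function, and for this continuous representative of $f$, $\displaystyle\lim_{\alpha\to\infty}|f(x)-J_\alpha f(x)|=0$ uniformly for $x\in\mathbb R$. -/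

import Mathlib

open MeasureTheory Filter Topology Set
open scoped ENNReal FourierTransform

namespace PWAmalgam

noncomputable section

/-- Lebesgue measure on the interval `[-π, π]`. -/
def muPi : Measure ℝ := volume.restrict (Icc (-Real.pi) Real.pi)

/-- The square-summable complex sequences indexed by `ℤ`. -/
abbrev L2Seq : Type := lp (fun _ : ℤ => ℂ) 2

/-- The complex-valued `L²` functions on `ℝ`. -/
abbrev L2R : Type := Lp ℂ 2 (volume : Measure ℝ)

/-- The constant `(2π)^{-1/2}`. -/
def normConst : ℂ := (((Real.sqrt (2 * Real.pi))⁻¹ : ℝ) : ℂ)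

/-- The Fourier transform `(2π)^{-1/2} ∫ φ(x) e^{-ixξ} dx` of a real-valued integrable function. -/
def fourierL1 (φ : ℝ → ℝ) (ξ : ℝ) : ℂ :=
  normConst * ∫ x : ℝ, (φ x : ℂ) * Complex.exp (-(Complex.I * (x : ℂ) * (ξ : ℂ)))

/-- The `L²` (Plancherel) Fourier transform in the same normalization, as a function defined up to
null sets. The Fourier transform `𝓕` of the library has kernel `e^{-2πi x ξ}`, hence the rescaling:
`(2π)^{-1/2} ∫ f(x) e^{-ixξ} dx = (2π)^{-1/2} (𝓕 f)(ξ / (2π))`. -/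
def fourierL2 (f : L2R) (ξ : ℝ) : ℂ :=
  normConst * (𝓕 f : L2R) (ξ / (2 * Real.pi))

/-- The norm of the Paley-Wiener amalgam space, with values in `[0, ∞]`:
`∑_{m ∈ ℤ} ‖f̂(ξ + 2πm)‖_{L²([-π, π])}`. -/
def pwNorm (f : L2R) : ℝ≥0∞ :=
  ∑' m : ℤ, eLpNorm (fun ξ : ℝ => fourierL2 f (ξ + 2 * Real.pi * m)) 2 muPi

/-- Membership in the Paley-Wiener amalgam space `(PW, l¹)`. -/
def MemPW (f : L2R) : Prop := pwNorm f < ∞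

/-- `(x n)` is a complete interpolating sequence for `L²([-π, π])`: the exponentials `e^{-i x_n ξ}`
form a Riesz basis of `L²([-π, π])`, i.e. they are the image of an orthonormal basis (the standard
one of `ℓ²(ℤ)`) under a bounded invertible linear operator. -/
def IsCompleteInterpolatingSeq (x : ℤ → ℝ) : Prop :=
  ∃ T : L2Seq ≃L[ℂ] Lp ℂ 2 muPi, ∀ n : ℤ,
    (T (lp.single 2 n (1 : ℂ)) : ℝ → ℂ) =ᵐ[muPi]
      fun ξ : ℝ => Complex.exp (-(Complex.I * (x n : ℂ) * (ξ : ℂ)))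

/-- `M_j = sup_{|ξ| ≤ π} φ̂(ξ + 2πj)` (used for `φ` with real-valued Fourier transform). -/
def bigM (φ : ℝ → ℝ) (j : ℤ) : ℝ :=
  sSup ((fun ξ : ℝ => (fourierL1 φ (ξ + 2 * Real.pi * j)).re) '' Icc (-Real.pi) Real.pi)

/-- `m = inf_{|ξ| ≤ π} φ̂(ξ)` (used for `φ` with real-valued Fourier transform). -/
def smallM (φ : ℝ → ℝ) : ℝ :=
  sInf ((fun ξ : ℝ => (fourierL1 φ ξ).re) '' Icc (-Real.pi) Real.pi)

/-- Interpolators for the Paley-Wiener space `PW_π`. -/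
structure IsInterpolator (φ : ℝ → ℝ) : Prop where
  integrable : Integrable φ volume
  continuous : Continuous φ
  integrable_fourier : Integrable (fourierL1 φ) volume
  fourier_real : ∀ ξ : ℝ, (fourierL1 φ ξ).im = 0
  fourier_nonneg : ∀ ξ : ℝ, 0 ≤ (fourierL1 φ ξ).re
  fourier_pos : ∃ δ : ℝ, 0 < δ ∧ ∀ ξ ∈ Icc (-Real.pi) Real.pi, δ ≤ (fourierL1 φ ξ).re
  summable_bigM : Summable (bigM φ)

/-- Regular families of interpolators `(φ α)`, `α ∈ A ⊆ (0, ∞)`. The filter `atTop ⊓ 𝓟 A` expresses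
`α → ∞` with `α ∈ A`. -/
structure IsRegularFamily (A : Set ℝ) (φ : ℝ → ℝ → ℝ) : Prop where
  index_pos : A ⊆ Ioi 0
  interpolator : ∀ α ∈ A, IsInterpolator (φ α)
  tail_bound : ∃ C : ℝ, ∀ α ∈ A, ∑' j : {j : ℤ // j ≠ 0}, bigM (φ α) j ≤ C * smallM (φ α)
  ratio_tendsto : ∀ᵐ ξ ∂muPi,
    Tendsto (fun α : ℝ => smallM (φ α) / (fourierL1 (φ α) ξ).re) (atTop ⊓ 𝓟 A) (𝓝 0)

/-- The function `g_m ∈ PW_π` whose Fourier transform is `f̂(ξ + 2πm)` on `[-π, π]` and `0` elsewhere,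
as an everywhere defined (entire) function, by Fourier inversion:
`g_m(t) = (2π)^{-1/2} ∫_{[-π, π]} f̂(ξ + 2πm) e^{itξ} dξ`. -/
def piece (f : L2R) (m : ℤ) (t : ℝ) : ℂ :=
  normConst * ∫ ξ : ℝ, fourierL2 f (ξ + 2 * Real.pi * m) *
    Complex.exp (Complex.I * (t : ℂ) * (ξ : ℂ)) ∂muPi

/-- `∑_{n ∈ ℤ} a_n φ(t - x_n)`. -/
def shiftSeries (φ : ℝ → ℝ) (x : ℤ → ℝ) (a : L2Seq) (t : ℝ) : ℂ :=
  ∑' n : ℤ, a n * (φ (t - x n) : ℂ)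

/-- The series with coefficients `a` takes the values of `g` at all the nodes `x k`. -/
def Interpolates (φ : ℝ → ℝ) (x : ℤ → ℝ) (g : ℝ → ℂ) (a : L2Seq) : Prop :=
  ∀ k : ℤ, shiftSeries φ x a (x k) = g (x k)

/-- The approximant `∑_{m ∈ ℤ} e^{2πimt} ∑_{n ∈ ℤ} a_{m,n} φ(t - x_n)`. -/
def approximant (φ : ℝ → ℝ) (x : ℤ → ℝ) (a : ℤ → L2Seq) (t : ℝ) : ℂ :=
  ∑' m : ℤ, Complex.exp (2 * (Real.pi : ℂ) * Complex.I * (m : ℂ) * (t : ℂ)) *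
    shiftSeries φ x (a m) t

end

end PWAmalgam

namespace PWAmalgam

noncomputable section

/-! Everything happens on the Fourier side, cut into cells `[-π, π] + 2πj`. Let `T` be the
isomorphism from `ℓ²(ℤ)` to `L²([-π, π])` given by the Riesz basis, `D j` the diagonal operator with
entries `e^{-2πi j x_n}`, and `Φ j` multiplication by `φ̂(· + 2πj)`. On cell `j` the transform of `∑
aₙ φ(· - xₙ)` is `Φ j (V j a)` with `V j = T ∘ D j`. Evaluation at `x_k` is pairing with `e^{-i x_k
ξ}`, so interpolating the function with transform `h` on the central cell is the normal equation `∑ⱼ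
Vⱼ* Φⱼ Vⱼ a = T* h` (`IsInterpolator.interpolates_iff`). All `Φ j` are nonnegative and `Φ 0 ≥ m >
0`, so the left side is coercive and the equation is uniquely solvable (`bijective_gram`).

Put `u = T a`. Pairing the equation with `a` gives `Re⟨u, Φ₀u⟩ ≤ Re⟨u, h⟩`, and completing a square
under the integral gives `m‖u‖ ≤ (∫ |h|² m/φ̂)^{1/2}` (`IsInterpolator.smallM_mul_norm_le`). The
error on the outer cells, and by the normal equation also the residual `h - Φ₀u` on the central one,
are at most a constant times `∑_{j≠0} ‖Φ j‖ ‖u‖ ≤ C m‖u‖`. So the amalgam norm of the error for one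
piece is controlled by the weighted norm of `h` (`IsInterpolator.tsum_norm_errorCell_le`), which is
at most `‖h‖` and tends to zero by dominated convergence.

Multiplication by `e^{2πimt}` moves cells by `m`, so the amalgam norm of the total error is at most
the sum of the errors of the pieces (`IsInterpolator.exists_error`). A second dominated convergence,
over `m`, proves B. The amalgam norm dominates both the `L²` norm and the sup norm, which gives A
and C. -/

/-! ### Fourier inversion on `L¹ ∩ L²` and the change of normalization. -/

/-- The `L²` inverse Fourier transform agrees with the inverse Fourier integral on `L¹ ∩ L²`. -/
theorem fourierInv_toLp_ae_eq {g : ℝ → ℂ} (h1 : Integrable g) (h2 : MemLp g 2) :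
    ((𝓕⁻ (h2.toLp g) : L2R) : ℝ → ℂ) =ᵐ[volume] 𝓕⁻ g := by
  have hcont : Continuous (𝓕⁻ g) := by
    rw [Real.fourierInv_eq_fourier_comp_neg]
    exact VectorFourier.fourierIntegral_continuous Real.continuous_fourierChar
      continuous_inner h1.comp_neg
  -- Both sides are locally integrable, so testing against smooth compactly supported functions
  -- suffices. The transform is moved onto the test function: by its definition on tempered
  -- distributions for the `L²` side, by Fubini for the integral.
  refine ae_eq_of_integral_contDiff_smul_eq
    ((Lp.memLp _).locallyIntegrable (by norm_num)) hcont.locallyIntegrable ?_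
  intro w hw hws
  set ψ : SchwartzMap ℝ ℂ := HasCompactSupport.toSchwartzMap (f := fun x => (w x : ℂ))
    (hws.comp_left (g := fun r : ℝ => (r : ℂ)) (by simp))
    (Complex.ofRealCLM.contDiff.comp hw) with hψ
  have hψx : ∀ x, ψ x = (w x : ℂ) := fun x => rfl
  have key := congrArg (fun T => T ψ) (Lp.fourierInv_toTemperedDistribution_eq (h2.toLp g))
  simp only [TemperedDistribution.fourierInv_apply, Lp.toTemperedDistribution_apply] at key
  have e1 : ∫ x, w x • ((𝓕⁻ (h2.toLp g) : L2R) : ℝ → ℂ) x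
      = ∫ x, ψ x • ((𝓕⁻ (h2.toLp g) : L2R) : ℝ → ℂ) x := by
    simp [hψx]
  have e2 : ∫ x, w x • 𝓕⁻ g x = ∫ x, ψ x • 𝓕⁻ g x := by
    simp [hψx]
  rw [e1, e2, ← key]
  have e3 : ∫ x, (𝓕⁻ ψ) x • (h2.toLp g : ℝ → ℂ) x = ∫ x, (𝓕⁻ (ψ : ℝ → ℂ)) x • g x := by
    refine integral_congr_ae ?_
    filter_upwards [h2.coeFn_toLp] with x hx
    rw [hx, SchwartzMap.fourierInv_coe]
  rw [e3]
  have := VectorFourier.integral_fourierIntegral_smul_eq_flip (L := -innerₗ ℝ)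
    (μ := volume) (ν := volume) Real.continuous_fourierChar
    (by simpa using! continuous_inner.neg) (ψ.integrable (μ := volume)) h1
  convert! this using 1
  simp [VectorFourier.fourierIntegral, Real.fourierInv_eq, mul_comm]

theorem normConst_mul_sqrt : normConst * ((Real.sqrt (2 * Real.pi) : ℝ) : ℂ) = 1 := by
  rw [normConst, ← Complex.ofReal_mul, inv_mul_cancel₀ (by positivity), Complex.ofReal_one]

theorem normConst_ne_zero : normConst ≠ 0 := left_ne_zero_of_mul_eq_one normConst_mul_sqrt

theorem fourierInv_rescale (G : ℝ → ℂ) (t : ℝ) :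
    𝓕⁻ (fun η : ℝ => ((Real.sqrt (2 * Real.pi) : ℝ) : ℂ) * G (2 * Real.pi * η)) t =
      normConst * ∫ ξ : ℝ, G ξ * Complex.exp (Complex.I * (t : ℂ) * (ξ : ℂ)) := by
  have hpi : (2 * Real.pi) ≠ 0 := by positivity
  set s : ℂ := ((Real.sqrt (2 * Real.pi) : ℝ) : ℂ) with hs
  have hh := Measure.integral_comp_mul_left
    (fun ξ : ℝ => s * (G ξ * Complex.exp (Complex.I * (t : ℂ) * (ξ : ℂ)))) (2 * Real.pi)
  have hl : 𝓕⁻ (fun η : ℝ => s * G (2 * Real.pi * η)) t = ∫ x : ℝ, s * (G (2 * Real.pi * x) *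
      Complex.exp (Complex.I * (t : ℂ) * ((2 * Real.pi * x : ℝ) : ℂ))) := by
    rw [Real.fourierInv_eq']
    refine integral_congr_ae (Eventually.of_forall fun x => ?_)
    simp only [smul_eq_mul, RCLike.inner_apply, conj_trivial]
    rw [mul_comm, mul_assoc]
    congr 3
    push_cast
    ring
  rw [hl, hh, integral_const_mul, Complex.real_smul, ← mul_assoc]
  congr 1
  have h3 : s * s = ((2 * Real.pi : ℝ) : ℂ) := by
    rw [hs, ← Complex.ofReal_mul, Real.mul_self_sqrt (by positivity)]
  have h4 : ((2 * Real.pi : ℝ) : ℂ) ≠ 0 := by exact_mod_cast hpi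
  have h5 := normConst_mul_sqrt
  rw [← hs] at h5
  have h6 : s ≠ 0 := right_ne_zero_of_mul_eq_one h5
  rw [abs_of_pos (by positivity), Complex.ofReal_inv, ← h3, eq_div_of_mul_eq h6 h5]
  field_simp

theorem quasiMeasurePreserving_div_two_pi :
    Measure.QuasiMeasurePreserving (fun η : ℝ => η / (2 * Real.pi)) volume volume := by
  refine ⟨by fun_prop, ?_⟩
  simp only [div_eq_mul_inv]
  rw [Real.map_volume_mul_right (inv_ne_zero (by positivity))]
  exact Measure.smul_absolutelyContinuous

/-- An inverse Fourier integral of `G ∈ L¹ ∩ L²` has Fourier transform `G`. -/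
theorem exists_fourierL2_eq {G : ℝ → ℂ} (h1 : Integrable G) (h2 : MemLp G 2) :
    ∃ J : L2R, (J : ℝ → ℂ) =ᵐ[volume]
        (fun t : ℝ => normConst * ∫ ξ : ℝ, G ξ * Complex.exp (Complex.I * (t : ℂ) * (ξ : ℂ))) ∧
      fourierL2 J =ᵐ[volume] G := by
  have hpi : (2 * Real.pi) ≠ 0 := by positivity
  set g : ℝ → ℂ := fun η => ((Real.sqrt (2 * Real.pi) : ℝ) : ℂ) * G (2 * Real.pi * η) with hg
  have g1 : Integrable g := (h1.comp_mul_left' hpi).const_mul _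
  have g2 : MemLp g 2 := by
    refine MemLp.const_mul ?_ _
    have : MemLp G 2 (Measure.map (fun η : ℝ => 2 * Real.pi * η) volume) := by
      rw [Real.map_volume_mul_left hpi]
      exact h2.smul_measure ENNReal.ofReal_ne_top
    exact this.comp_of_map (by fun_prop)
  refine ⟨𝓕⁻ (g2.toLp g), (fourierInv_toLp_ae_eq g1 g2).trans
    (Eventually.of_forall (fourierInv_rescale G)), ?_⟩
  have : (𝓕 (𝓕⁻ (g2.toLp g)) : L2R) = g2.toLp g := FourierTransform.fourier_fourierInv_eq _
  filter_upwards [quasiMeasurePreserving_div_two_pi.ae_eq_comp g2.coeFn_toLp] with ξ hξ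
  simp only [Function.comp] at hξ
  rw [fourierL2, this, hξ, hg]
  simp only
  rw [← mul_assoc, normConst_mul_sqrt, one_mul, mul_div_cancel₀ _ hpi]

/-! ### The real line as a union of translates of `[-π, π]`. -/

theorem muPi_eq_restrict_Ioc : muPi = volume.restrict (Ioc (-Real.pi) Real.pi) :=
  Measure.restrict_congr_set Ioc_ae_eq_Icc.symm

instance : IsFiniteMeasure muPi := by
  rw [muPi]; infer_instance

/-- Lebesgue measure is the sum of the translates of `muPi` by multiples of `2π`. -/
theorem volume_eq_sum_map_muPi :
    (volume : Measure ℝ) =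
      Measure.sum fun j : ℤ => Measure.map (fun ξ : ℝ => ξ + 2 * Real.pi * j) muPi := by
  have hp : (0 : ℝ) < 2 * Real.pi := by positivity
  have key : ∀ j : ℤ, Measure.map (fun ξ : ℝ => ξ + 2 * Real.pi * j) muPi
      = volume.restrict (Ioc (-Real.pi + j • (2 * Real.pi)) (-Real.pi + (j + 1) • (2 * Real.pi))) := by
    intro j
    have hpre : Ioc (-Real.pi) Real.pi = (fun ξ : ℝ => ξ + 2 * Real.pi * j) ⁻¹'
        (Ioc (-Real.pi + j • (2 * Real.pi)) (-Real.pi + (j + 1) • (2 * Real.pi))) := by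
      ext ξ
      simp only [mem_Ioc, mem_preimage, zsmul_eq_mul, Int.cast_add, Int.cast_one]
      constructor <;> rintro ⟨h, h'⟩ <;> constructor <;> linarith
    rw [muPi_eq_restrict_Ioc, hpre, ← Measure.restrict_map (by fun_prop) measurableSet_Ioc]
    rw [(measurePreserving_add_right volume (2 * Real.pi * (j : ℝ))).map_eq]
  simp_rw [key]
  rw [← Measure.restrict_iUnion (pairwise_disjoint_Ioc_add_zsmul _ _) (fun _ => measurableSet_Ioc),
    iUnion_Ioc_add_zsmul hp, Measure.restrict_univ]

theorem measurableEmbedding_shift (j : ℤ) :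
    MeasurableEmbedding fun ξ : ℝ => ξ + 2 * Real.pi * j :=
  measurableEmbedding_addRight _

theorem lintegral_eq_tsum_muPi (g : ℝ → ℝ≥0∞) :
    ∫⁻ ξ, g ξ = ∑' j : ℤ, ∫⁻ ξ, g (ξ + 2 * Real.pi * j) ∂muPi := by
  conv_lhs => rw [volume_eq_sum_map_muPi]
  rw [lintegral_sum_measure]
  simp_rw [(measurableEmbedding_shift _).lintegral_map]

theorem hasSum_integral_muPi {g : ℝ → ℂ} (hg : Integrable g) :
    HasSum (fun j : ℤ => ∫ ξ, g (ξ + 2 * Real.pi * j) ∂muPi) (∫ ξ, g ξ) := by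
  have := hasSum_integral_measure (f := g)
    (μ := fun j : ℤ => Measure.map (fun ξ : ℝ => ξ + 2 * Real.pi * j) muPi)
    (by rwa [← volume_eq_sum_map_muPi])
  rw [← volume_eq_sum_map_muPi] at this
  simpa only [(measurableEmbedding_shift _).integral_map] using! this

theorem ae_iff_forall_ae_muPi {p : ℝ → Prop} :
    (∀ᵐ ξ, p ξ) ↔ ∀ j : ℤ, ∀ᵐ ξ ∂muPi, p (ξ + 2 * Real.pi * j) := by
  conv_lhs => rw [volume_eq_sum_map_muPi]
  rw [Measure.ae_sum_iff]
  simp_rw [(measurableEmbedding_shift _).ae_map_iff]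


/-! ### Plancherel, cell parts and the amalgam norm. -/

/-- The space `L²([-π, π])`. -/
abbrev L2Pi : Type := Lp ℂ 2 muPi

theorem muPi_univ : muPi univ = ENNReal.ofReal (2 * Real.pi) := by
  rw [muPi, Measure.restrict_apply_univ, Real.volume_Icc]
  congr 1
  ring

theorem norm_normConst : ‖normConst‖ = (Real.sqrt (2 * Real.pi))⁻¹ := by
  rw [normConst, Complex.norm_real, Real.norm_of_nonneg (by positivity)]

/-- Plancherel's theorem for the normalization `fourierL2`. -/
theorem eLpNorm_fourierL2 (f : L2R) : eLpNorm (fourierL2 f) 2 volume = ‖f‖ₑ := by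
  have h1 : fourierL2 f = normConst • ((𝓕 f : L2R) ∘ fun η : ℝ => η / (2 * Real.pi)) := rfl
  have hpi : (0 : ℝ) < 2 * Real.pi := by positivity
  have hmap : Measure.map (fun η : ℝ => η / (2 * Real.pi)) volume
      = ENNReal.ofReal (2 * Real.pi) • volume := by
    simp only [div_eq_mul_inv]
    rw [Real.map_volume_mul_right (inv_ne_zero hpi.ne'), inv_inv, abs_of_pos hpi]
  have hmeas : AEStronglyMeasurable (𝓕 f : L2R)
      (Measure.map (fun η : ℝ => η / (2 * Real.pi)) volume) :=
    (Lp.stronglyMeasurable _).aestronglyMeasurable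
  rw [h1, eLpNorm_const_smul, ← eLpNorm_map_measure hmeas (by fun_prop), hmap,
    eLpNorm_smul_measure_of_ne_top (by norm_num), ← Lp.enorm_def]
  have hn : ‖(𝓕 f : L2R)‖ₑ = ‖f‖ₑ := by
    rw [← ofReal_norm, ← ofReal_norm, Lp.norm_fourier_eq]
  rw [hn, smul_eq_mul, ← mul_assoc, ← ofReal_norm normConst, norm_normConst]
  have h2 : ENNReal.ofReal (2 * Real.pi) ^ (1 / (2 : ℝ≥0∞)).toReal
      = ENNReal.ofReal (Real.sqrt (2 * Real.pi)) := by
    rw [ENNReal.ofReal_rpow_of_pos hpi, Real.sqrt_eq_rpow]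
    norm_num
  rw [h2, ← ENNReal.ofReal_mul (by positivity), inv_mul_cancel₀ (by positivity),
    ENNReal.ofReal_one, one_mul]

theorem stronglyMeasurable_fourierL2 (f : L2R) : StronglyMeasurable (fourierL2 f) :=
  ((Lp.stronglyMeasurable (𝓕 f : L2R)).comp_measurable (by fun_prop)).const_mul _

theorem memLp_fourierL2 (f : L2R) : MemLp (fourierL2 f) 2 volume :=
  ⟨(stronglyMeasurable_fourierL2 f).aestronglyMeasurable, by
    rw [eLpNorm_fourierL2]; exact enorm_lt_top⟩

theorem fourierL2_sub (f g : L2R) :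
    fourierL2 (f - g) =ᵐ[volume] fourierL2 f - fourierL2 g := by
  have h : (𝓕 (f - g) : L2R) = 𝓕 f - 𝓕 g := (Lp.fourierTransformₗᵢ ℝ ℂ).map_sub f g
  filter_upwards [quasiMeasurePreserving_div_two_pi.ae_eq_comp
    (Lp.coeFn_sub (𝓕 f : L2R) (𝓕 g))] with ξ hξ
  simp only [Function.comp, Pi.sub_apply] at hξ
  simp only [fourierL2, Pi.sub_apply, h, hξ, mul_sub]

theorem memLp_fourierL2_shift (f : L2R) (m : ℤ) :
    MemLp (fun ξ : ℝ => fourierL2 f (ξ + 2 * Real.pi * m)) 2 muPi :=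
  ((memLp_fourierL2 f).comp_measurePreserving
    (measurePreserving_add_right volume (2 * Real.pi * (m : ℝ)))).restrict _

/-- The part of the Fourier transform of `f` living on `[-π, π] + 2πm`, moved to `[-π, π]`. -/
def cellPart (f : L2R) (m : ℤ) : L2Pi := (memLp_fourierL2_shift f m).toLp

theorem coeFn_cellPart (f : L2R) (m : ℤ) :
    (cellPart f m : ℝ → ℂ) =ᵐ[muPi] fun ξ : ℝ => fourierL2 f (ξ + 2 * Real.pi * m) :=
  MemLp.coeFn_toLp _

theorem cellPart_sub (f g : L2R) (m : ℤ) : cellPart (f - g) m = cellPart f m - cellPart g m := by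
  apply Lp.ext
  have h := ae_iff_forall_ae_muPi.1 (fourierL2_sub f g) m
  filter_upwards [coeFn_cellPart (f - g) m, coeFn_cellPart f m, coeFn_cellPart g m,
    Lp.coeFn_sub (cellPart f m) (cellPart g m), h] with ξ h1 h2 h3 h4 h5
  rw [h1, h4, Pi.sub_apply, h2, h3, h5, Pi.sub_apply]

theorem pwNorm_eq_tsum (f : L2R) : pwNorm f = ∑' m : ℤ, ‖cellPart f m‖ₑ := by
  refine tsum_congr fun m => ?_
  rw [Lp.enorm_def]
  exact (eLpNorm_congr_ae (coeFn_cellPart f m)).symm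

theorem summable_norm_of_tsum_enorm {ι E : Type*} [NormedAddCommGroup E] {c : ι → E}
    (h : ∑' i, ‖c i‖ₑ < ∞) : Summable fun i => ‖c i‖ := by
  have := ENNReal.summable_toReal h.ne
  simpa using this

theorem tsum_enorm_eq_ofReal {ι E : Type*} [NormedAddCommGroup E] {c : ι → E}
    (h : Summable fun i => ‖c i‖) : ∑' i, ‖c i‖ₑ = ENNReal.ofReal (∑' i, ‖c i‖) := by
  rw [ENNReal.ofReal_tsum_of_nonneg (fun _ => norm_nonneg _) h]
  simp_rw [ofReal_norm]

theorem eLpNorm_two_sq {μ : Measure ℝ} (g : ℝ → ℂ) :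
    eLpNorm g 2 μ ^ 2 = ∫⁻ ξ, ‖g ξ‖ₑ ^ 2 ∂μ := by
  have := eLpNorm_nnreal_pow_eq_lintegral (f := g) (μ := μ) (p := 2) (by norm_num)
  simpa using this

/-- This is `ℓ² ≤ ℓ¹` over the cells: in the sum of squares, one factor of each square is bounded by
the whole sum. -/
theorem eLpNorm_two_le_tsum (g : ℝ → ℂ) :
    eLpNorm g 2 volume ≤ ∑' j : ℤ, eLpNorm (fun ξ => g (ξ + 2 * Real.pi * j)) 2 muPi := by
  rw [← ENNReal.pow_le_pow_left_iff two_ne_zero, eLpNorm_two_sq, lintegral_eq_tsum_muPi, sq,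
    ← ENNReal.tsum_mul_right]
  refine ENNReal.tsum_le_tsum fun j => ?_
  rw [← eLpNorm_two_sq (fun ξ => g (ξ + 2 * Real.pi * j)), sq]
  exact mul_le_mul_right (ENNReal.le_tsum j) _

theorem enorm_le_pwNorm (f : L2R) : ‖f‖ₑ ≤ pwNorm f := by
  rw [← eLpNorm_fourierL2]
  exact eLpNorm_two_le_tsum _

/-! ### Exponentials and point evaluation on `PW_π`. -/

theorem memLp_expPi (t : ℝ) :
    MemLp (fun ξ : ℝ => Complex.exp (-(Complex.I * (t : ℂ) * (ξ : ℂ)))) 2 muPi := by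
  refine MemLp.of_bound (Continuous.aestronglyMeasurable (by fun_prop)) 1
    (Eventually.of_forall fun ξ => ?_)
  have : -(Complex.I * (t : ℂ) * (ξ : ℂ)) = ((-(t * ξ) : ℝ) : ℂ) * Complex.I := by
    push_cast; ring
  rw [this, Complex.norm_exp_ofReal_mul_I]

/-- The exponential `e^{-itξ}` as an element of `L²([-π, π])`. -/
def expPi (t : ℝ) : L2Pi := (memLp_expPi t).toLp

theorem coeFn_expPi (t : ℝ) : (expPi t : ℝ → ℂ) =ᵐ[muPi]
    fun ξ : ℝ => Complex.exp (-(Complex.I * (t : ℂ) * (ξ : ℂ))) := MemLp.coeFn_toLp _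

theorem norm_expPi (t : ℝ) : ‖expPi t‖ ≤ Real.sqrt (2 * Real.pi) := by
  have h := Lp.norm_le_of_ae_bound (f := expPi t) (C := 1) zero_le_one (by
    filter_upwards [coeFn_expPi t] with ξ hξ
    have : -(Complex.I * (t : ℂ) * (ξ : ℂ)) = ((-(t * ξ) : ℝ) : ℂ) * Complex.I := by
      push_cast; ring
    rw [hξ, this, Complex.norm_exp_ofReal_mul_I])
  refine h.trans (le_of_eq ?_)
  rw [measureUnivNNReal, muPi_univ, Real.sqrt_eq_rpow, mul_one, ENNReal.coe_toNNReal_eq_toReal,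
    ENNReal.toReal_ofReal (by positivity)]
  norm_num

/-- Evaluation at `t` of the function in `PW_π` whose Fourier transform is given. -/
def evalPi (t : ℝ) : L2Pi →L[ℂ] ℂ := normConst • innerSL ℂ (expPi t)

theorem evalPi_apply_inner (t : ℝ) (h : L2Pi) :
    evalPi t h = normConst * inner ℂ (expPi t) h := rfl

theorem evalPi_apply (t : ℝ) (h : L2Pi) :
    evalPi t h =
      normConst * ∫ ξ : ℝ, h ξ * Complex.exp (Complex.I * (t : ℂ) * (ξ : ℂ)) ∂muPi := by
  rw [evalPi_apply_inner, L2.inner_def]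
  congr 1
  refine integral_congr_ae ?_
  filter_upwards [coeFn_expPi t] with ξ hξ
  rw [hξ, RCLike.inner_apply, ← Complex.exp_conj]
  simp

/-- Cauchy–Schwarz: the factor `(2π)^{-1/2}` exactly cancels the bound `√(2π)` for the norm of the
exponential. Summed over cells, this bounds the sup norm by the amalgam norm. -/
theorem norm_evalPi_apply_le (t : ℝ) (h : L2Pi) : ‖evalPi t h‖ ≤ ‖h‖ := by
  rw [evalPi_apply_inner, norm_mul, norm_normConst]
  have h1 := (norm_inner_le_norm (𝕜 := ℂ) (expPi t) h).trans
    (mul_le_mul_of_nonneg_right (norm_expPi t) (norm_nonneg h))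
  calc _ ≤ (Real.sqrt (2 * Real.pi))⁻¹ * (Real.sqrt (2 * Real.pi) * ‖h‖) := by gcongr
    _ = ‖h‖ := by rw [← mul_assoc, inv_mul_cancel₀ (by positivity), one_mul]

theorem continuous_evalPi (h : L2Pi) : Continuous fun t : ℝ => evalPi t h := by
  simp_rw [evalPi_apply]
  refine continuous_const.mul ?_
  have hint : Integrable h muPi := (Lp.memLp h).integrable (by norm_num)
  refine continuous_of_dominated (bound := fun ξ => ‖h ξ‖) (fun t => ?_) (fun t => ?_)
    hint.norm ?_
  · exact hint.aestronglyMeasurable.mul (Continuous.aestronglyMeasurable (by fun_prop))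
  · refine Eventually.of_forall fun ξ => ?_
    have : Complex.I * (t : ℂ) * (ξ : ℂ) = ((t * ξ : ℝ) : ℂ) * Complex.I := by
      push_cast; ring
    rw [norm_mul, this, Complex.norm_exp_ofReal_mul_I, mul_one]
  · exact Eventually.of_forall fun ξ => by fun_prop

theorem piece_eq_evalPi (f : L2R) (m : ℤ) (t : ℝ) : piece f m t = evalPi t (cellPart f m) := by
  rw [evalPi_apply, piece]
  congr 1
  refine integral_congr_ae ?_
  filter_upwards [coeFn_cellPart f m] with ξ hξ
  rw [hξ]

/-! ### Characters and pointwise synthesis from cells. -/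

/-- The character `e^{2πimt}`. -/
def character (m : ℤ) (t : ℝ) : ℂ :=
  Complex.exp (2 * (Real.pi : ℂ) * Complex.I * (m : ℂ) * (t : ℂ))

theorem norm_character (m : ℤ) (t : ℝ) : ‖character m t‖ = 1 := by
  have : 2 * (Real.pi : ℂ) * Complex.I * (m : ℂ) * (t : ℂ)
      = ((2 * Real.pi * m * t : ℝ) : ℂ) * Complex.I := by push_cast; ring
  rw [character, this, Complex.norm_exp_ofReal_mul_I]

theorem character_add (m n : ℤ) (t : ℝ) :
    character (m + n) t = character m t * character n t := by
  rw [character, character, character, ← Complex.exp_add]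
  congr 1
  push_cast
  ring

theorem continuous_character (m : ℤ) : Continuous (character m) := by
  unfold character
  fun_prop

theorem norm_character_mul_evalPi_le (j : ℤ) (t : ℝ) (h : L2Pi) :
    ‖character j t * evalPi t h‖ ≤ ‖h‖ := by
  rw [norm_mul, norm_character, one_mul]
  exact norm_evalPi_apply_le t h

/-- The function whose Fourier transform on `[-π, π] + 2πj` is a translate of `c j`. -/
def synth (c : ℤ → L2Pi) (t : ℝ) : ℂ := ∑' j : ℤ, character j t * evalPi t (c j)

theorem summable_synth {c : ℤ → L2Pi} (hc : Summable fun j => ‖c j‖) (t : ℝ) :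
    Summable fun j : ℤ => character j t * evalPi t (c j) :=
  Summable.of_norm_bounded hc fun j => norm_character_mul_evalPi_le j t (c j)

theorem norm_synth_le {c : ℤ → L2Pi} (hc : Summable fun j => ‖c j‖) (t : ℝ) :
    ‖synth c t‖ ≤ ∑' j, ‖c j‖ :=
  tsum_of_norm_bounded hc.hasSum fun j => norm_character_mul_evalPi_le j t (c j)

theorem synth_sub {c d : ℤ → L2Pi} (hc : Summable fun j => ‖c j‖) (hd : Summable fun j => ‖d j‖)
    (t : ℝ) : synth (fun j => c j - d j) t = synth c t - synth d t := by
  rw [synth, synth, synth, ← (summable_synth hc t).tsum_sub (summable_synth hd t)]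
  simp only [map_sub, mul_sub]

theorem continuous_synth {c : ℤ → L2Pi} (hc : Summable fun j => ‖c j‖) : Continuous (synth c) :=
  continuous_tsum (fun j => (continuous_character j).mul (continuous_evalPi (c j))) hc
    fun j t => norm_character_mul_evalPi_le j t (c j)

/-! ### Gluing cells into a function on the line. -/

/-- The integer `j` such that `ξ ∈ (-π, π] + 2πj`. -/
def cellIndex (ξ : ℝ) : ℤ := ⌈(ξ - Real.pi) / (2 * Real.pi)⌉

theorem cellIndex_add {ξ : ℝ} (hξ : ξ ∈ Ioc (-Real.pi) Real.pi) (j : ℤ) :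
    cellIndex (ξ + 2 * Real.pi * j) = j := by
  have hpi : (0 : ℝ) < 2 * Real.pi := by positivity
  rw [cellIndex, Int.ceil_eq_iff, lt_div_iff₀ hpi, div_le_iff₀ hpi]
  constructor <;> nlinarith [hξ.1, hξ.2]

/-- The function on `ℝ` given by translates of `c j` on the cells `(-π, π] + 2πj`. -/
def glue (c : ℤ → L2Pi) (ξ : ℝ) : ℂ := c (cellIndex ξ) (ξ - 2 * Real.pi * cellIndex ξ)

theorem measurable_glue (c : ℤ → L2Pi) : Measurable (glue c) := by
  -- The cell index ranges over a countable set, so joint measurability reduces to measurability for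
  -- each fixed index.
  have h1 : Measurable fun p : ℝ × ℤ => (c p.2 : ℝ → ℂ) (p.1 - 2 * Real.pi * p.2) :=
    measurable_from_prod_countable_left fun j =>
      (Lp.stronglyMeasurable (c j)).measurable.comp (by fun_prop)
  have h2 : Measurable cellIndex := Int.measurable_ceil.comp (by fun_prop)
  exact h1.comp (measurable_id.prodMk h2)

theorem glue_shift_ae_eq (c : ℤ → L2Pi) (j : ℤ) :
    (fun ξ => glue c (ξ + 2 * Real.pi * j)) =ᵐ[muPi] c j := by
  -- The ceiling in `cellIndex` selects half-open cells; the lost endpoint `-π` is a null set.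
  have h : ∀ᵐ ξ ∂muPi, ξ ∈ Ioc (-Real.pi) Real.pi := by
    rw [muPi_eq_restrict_Ioc]
    exact ae_restrict_mem measurableSet_Ioc
  filter_upwards [h] with ξ hξ
  rw [glue, cellIndex_add hξ, add_sub_cancel_right]

theorem memLp_glue {c : ℤ → L2Pi} (hc : Summable fun j => ‖c j‖) : MemLp (glue c) 2 volume := by
  refine ⟨(measurable_glue c).aestronglyMeasurable, (eLpNorm_two_le_tsum _).trans_lt ?_⟩
  simp_rw [eLpNorm_congr_ae (glue_shift_ae_eq c _), ← Lp.enorm_def]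
  rw [tsum_enorm_eq_ofReal hc]
  exact ENNReal.ofReal_lt_top

/-- Each cell has finite measure, so its `L¹` norm is at most a fixed multiple of its `L²` norm, and
the latter are summable. -/
theorem integrable_glue {c : ℤ → L2Pi} (hc : Summable fun j => ‖c j‖) :
    Integrable (glue c) volume := by
  refine ⟨(measurable_glue c).aestronglyMeasurable, ?_⟩
  rw [HasFiniteIntegral, lintegral_eq_tsum_muPi]
  have h : ∀ j : ℤ, ∫⁻ ξ, ‖glue c (ξ + 2 * Real.pi * j)‖ₑ ∂muPi
      ≤ ‖c j‖ₑ * muPi univ ^ (1 / (1 : ℝ≥0∞).toReal - 1 / (2 : ℝ≥0∞).toReal) := by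
    intro j
    rw [← eLpNorm_one_eq_lintegral_enorm (f := fun ξ => glue c (ξ + 2 * Real.pi * j)),
      eLpNorm_congr_ae (glue_shift_ae_eq c _), Lp.enorm_def]
    exact eLpNorm_le_eLpNorm_mul_rpow_measure_univ (by norm_num)
      (Lp.stronglyMeasurable _).aestronglyMeasurable
  refine (ENNReal.tsum_le_tsum h).trans_lt ?_
  rw [ENNReal.tsum_mul_right, tsum_enorm_eq_ofReal hc]
  exact ENNReal.mul_lt_top ENNReal.ofReal_lt_top
    (ENNReal.rpow_lt_top_of_nonneg (by norm_num) (measure_ne_top _ _))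

/-- The glued function lies in `L¹ ∩ L²`, so inversion applies, and splitting the inversion integral
over cells turns it into `synth`. This produces both the class of the approximant and the continuous
representative of `f`. -/
theorem exists_cellPart_eq {c : ℤ → L2Pi} (hc : Summable fun j => ‖c j‖) :
    ∃ J : L2R, (J : ℝ → ℂ) =ᵐ[volume] synth c ∧ ∀ j, cellPart J j = c j := by
  obtain ⟨J, hJ, hF⟩ := exists_fourierL2_eq (integrable_glue hc) (memLp_glue hc)
  refine ⟨J, hJ.trans (Eventually.of_forall fun t => ?_), fun j => ?_⟩
  · have hint : Integrable fun ξ : ℝ =>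
        glue c ξ * Complex.exp (Complex.I * (t : ℂ) * (ξ : ℂ)) := by
      refine (integrable_glue hc).mul_bdd (c := 1)
        (Continuous.aestronglyMeasurable (by fun_prop)) (Eventually.of_forall fun ξ => ?_)
      have : Complex.I * (t : ℂ) * (ξ : ℂ) = ((t * ξ : ℝ) : ℂ) * Complex.I := by
        push_cast; ring
      rw [this, Complex.norm_exp_ofReal_mul_I]
    have hs := ((hasSum_integral_muPi hint).mul_left normConst).tsum_eq
    refine hs.symm.trans (tsum_congr fun j => ?_)
    rw [evalPi_apply, mul_left_comm, ← integral_const_mul (character j t)]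
    refine congrArg (normConst * ·) (integral_congr_ae ?_)
    filter_upwards [glue_shift_ae_eq c j] with ξ hξ
    rw [hξ, mul_left_comm, character, ← Complex.exp_add]
    congr 2
    push_cast
    ring
  · apply Lp.ext
    filter_upwards [coeFn_cellPart J j, ae_iff_forall_ae_muPi.1 hF j, glue_shift_ae_eq c j]
      with ξ h1 h2 h3
    rw [h1, h2, h3]

theorem eq_of_cellPart_eq {f g : L2R} (h : ∀ j, cellPart f j = cellPart g j) : f = g := by
  have h1 : ‖f - g‖ₑ ≤ 0 := by
    refine (enorm_le_pwNorm _).trans (le_of_eq ?_)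
    simp [pwNorm_eq_tsum, cellPart_sub, h]
  simpa [sub_eq_zero] using h1

theorem tsum_eq_zero_add_tsum_ne {E : Type*} [NormedAddCommGroup E] [CompleteSpace E] {f : ℤ → E}
    (hf : Summable f) : ∑' j, f j = f 0 + ∑' j : {j : ℤ // j ≠ 0}, f j := by
  have h := hf.sum_add_tsum_subtype_compl {0}
  rw [Finset.sum_singleton] at h
  rw [← h]
  congr 1
  exact (Equiv.subtypeEquivRight (p := fun j : ℤ => j ≠ 0) (q := fun j : ℤ => j ∉ ({0} : Finset ℤ))
    (by simp)).tsum_eq (fun j => f j) |>.symm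

/-! ### The abstract normal equation `∑ⱼ Vⱼ* Φⱼ Vⱼ a = T* h`. -/

section Gram

variable {K H : Type*} [NormedAddCommGroup K] [InnerProductSpace ℂ K]
  [NormedAddCommGroup H] [InnerProductSpace ℂ H] {V : ℤ → K →L[ℂ] H} {Φ : ℤ → H →L[ℂ] H} {B : ℝ}

theorem norm_apply_apply_le (hV : ∀ j, ‖V j‖ ≤ B) (j : ℤ) (a : K) :
    ‖Φ j (V j a)‖ ≤ ‖Φ j‖ * (B * ‖a‖) :=
  ((Φ j).le_opNorm _).trans (mul_le_mul_of_nonneg_left ((V j).le_of_opNorm_le (hV j) a)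
    (norm_nonneg _))

theorem norm_le_symm (T : K ≃L[ℂ] H) (a : K) : ‖a‖ ≤ ‖(T.symm : H →L[ℂ] K)‖ * ‖T a‖ := by
  simpa using (T.symm : H →L[ℂ] K).le_opNorm (T a)

/-- The tail of a solution of the normal equation is controlled by the tail of the symbols. -/
theorem tail_le (hV : ∀ j, ‖V j‖ ≤ B) (hΦ : Summable fun j => ‖Φ j‖) {T : K ≃L[ℂ] H} (a : K) :
    ∑' j : {j : ℤ // j ≠ 0}, ‖Φ j (V j a)‖ ≤
      B * ‖(T.symm : H →L[ℂ] K)‖ * (∑' j : {j : ℤ // j ≠ 0}, ‖Φ j‖) * ‖T a‖ := by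
  have hB : 0 ≤ B := (norm_nonneg _).trans (hV 0)
  have hs : Summable fun j : {j : ℤ // j ≠ 0} => ‖Φ j‖ := hΦ.subtype _
  have h1 : ∀ j : {j : ℤ // j ≠ 0}, ‖Φ j (V j a)‖ ≤
      ‖Φ j‖ * (B * (‖(T.symm : H →L[ℂ] K)‖ * ‖T a‖)) := fun j => by
    refine (norm_apply_apply_le hV j a).trans ?_
    gcongr
    exact norm_le_symm T a
  have h2 := Summable.of_nonneg_of_le (fun _ => norm_nonneg _) h1 (hs.mul_right _)
  refine (h2.tsum_le_tsum h1 (hs.mul_right _)).trans (le_of_eq ?_)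
  rw [tsum_mul_right]
  ring

variable [CompleteSpace K] [CompleteSpace H]

/-- The operator `∑ⱼ Vⱼ* Φⱼ Vⱼ`. -/
def gram (V : ℤ → K →L[ℂ] H) (Φ : ℤ → H →L[ℂ] H) : K →L[ℂ] K :=
  ∑' j, (ContinuousLinearMap.adjoint (V j)) ∘L (Φ j) ∘L (V j)

/-- The operator series converges absolutely because its terms have norm at most `B² ‖Φ j‖`; all
later arguments use only this weak form. -/
theorem hasSum_inner_gram (hV : ∀ j, ‖V j‖ ≤ B) (hΦ : Summable fun j => ‖Φ j‖) (b a : K) :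
    HasSum (fun j => inner ℂ (V j b) (Φ j (V j a))) (inner ℂ b (gram V Φ a)) := by
  have hs : Summable fun j => (ContinuousLinearMap.adjoint (V j)) ∘L (Φ j) ∘L (V j) := by
    refine Summable.of_norm_bounded ((hΦ.mul_left (B * B))) fun j => ?_
    have hB : 0 ≤ B := (norm_nonneg _).trans (hV j)
    calc _ ≤ ‖ContinuousLinearMap.adjoint (V j)‖ * (‖Φ j‖ * ‖V j‖) :=
          (ContinuousLinearMap.opNorm_comp_le _ _).trans
            (mul_le_mul_of_nonneg_left (ContinuousLinearMap.opNorm_comp_le _ _) (norm_nonneg _))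
      _ ≤ B * (‖Φ j‖ * B) := by
          rw [LinearIsometryEquiv.norm_map]
          gcongr <;> exact hV j
      _ = B * B * ‖Φ j‖ := by ring
  have := hs.hasSum.mapL ((innerSL ℂ b) ∘L (ContinuousLinearMap.apply ℂ K a))
  simpa [ContinuousLinearMap.adjoint_inner_right] using! this

variable {T : K ≃L[ℂ] H} {m : ℝ}

theorem re_inner_gram_ge (hV : ∀ j, ‖V j‖ ≤ B) (hΦ : Summable fun j => ‖Φ j‖)
    (hpos : ∀ j h, 0 ≤ (inner ℂ h (Φ j h)).re) (hV0 : ∀ a, V 0 a = T a) (a : K) :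
    (inner ℂ (T a) (Φ 0 (T a))).re ≤ (inner ℂ a (gram V Φ a)).re := by
  have h := (hasSum_inner_gram hV hΦ a a).mapL Complex.reCLM
  rw [← hV0]
  exact le_hasSum h 0 fun j _ => hpos j _

/-- Lax–Milgram: coercivity comes from the term `j = 0` alone, since the others are nonnegative and
`T` is bounded below. -/
theorem bijective_gram (hV : ∀ j, ‖V j‖ ≤ B) (hΦ : Summable fun j => ‖Φ j‖)
    (hpos : ∀ j h, 0 ≤ (inner ℂ h (Φ j h)).re) (hV0 : ∀ a, V 0 a = T a) (hm : 0 < m)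
    (hlow : ∀ h, m * ‖h‖ ^ 2 ≤ (inner ℂ h (Φ 0 h)).re) :
    Function.Bijective (gram V Φ) := by
  obtain ⟨c, hc, hcT⟩ : ∃ c > 0, ∀ a, c * ‖a‖ ≤ ‖T a‖ := by
    -- Adding `1` keeps the constant positive even when `T.symm` has norm zero.
    refine ⟨(‖(T.symm : H →L[ℂ] K)‖ + 1)⁻¹, by positivity, fun a => ?_⟩
    rw [inv_mul_le_iff₀ (by positivity)]
    have := (T.symm : H →L[ℂ] K).le_opNorm (T a)
    simp only [ContinuousLinearEquiv.coe_coe, ContinuousLinearEquiv.symm_apply_apply] at this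
    nlinarith [norm_nonneg (T a)]
  have hu : IsUnit (gram V Φ) := by
    refine ContinuousLinearMap.isUnit_of_forall_le_norm_inner_map _
      (c := ⟨m * c ^ 2, by positivity⟩) (show 0 < m * c ^ 2 by positivity) fun a => ?_
    calc ‖a‖ ^ 2 * (m * c ^ 2) = m * (c * ‖a‖) ^ 2 := by ring
      _ ≤ m * ‖T a‖ ^ 2 := by gcongr; exact hcT a
      _ ≤ (inner ℂ a (gram V Φ a)).re := (hlow _).trans (re_inner_gram_ge hV hΦ hpos hV0 a)
      _ ≤ ‖inner ℂ a (gram V Φ a)‖ := Complex.re_le_norm _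
      _ = ‖inner ℂ (gram V Φ a) a‖ := norm_inner_symm _ _
  exact ContinuousLinearMap.isUnit_iff_bijective.1 hu

theorem re_inner_le_of_gram_eq (hV : ∀ j, ‖V j‖ ≤ B) (hΦ : Summable fun j => ‖Φ j‖)
    (hpos : ∀ j h, 0 ≤ (inner ℂ h (Φ j h)).re) (hV0 : ∀ a, V 0 a = T a) {a : K} {h : H}
    (ha : gram V Φ a = ContinuousLinearMap.adjoint (T : K →L[ℂ] H) h) :
    (inner ℂ (T a) (Φ 0 (T a))).re ≤ (inner ℂ (T a) h).re := by
  have := re_inner_gram_ge hV hΦ hpos hV0 a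
  rwa [ha, ContinuousLinearMap.adjoint_inner_right] at this

/-- The residual of a solution of the normal equation is controlled by the tail of the symbols. -/
theorem residual_le (hV : ∀ j, ‖V j‖ ≤ B) (hΦ : Summable fun j => ‖Φ j‖)
    (hV0 : ∀ a, V 0 a = T a) {a : K} {h : H}
    (ha : gram V Φ a = ContinuousLinearMap.adjoint (T : K →L[ℂ] H) h) :
    ‖h - Φ 0 (T a)‖ ≤
      (B * ‖(T.symm : H →L[ℂ] K)‖) ^ 2 * (∑' j : {j : ℤ // j ≠ 0}, ‖Φ j‖) * ‖T a‖ := by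
  have hB : 0 ≤ B := (norm_nonneg _).trans (hV 0)
  set r := h - Φ 0 (T a) with hr
  -- Tested against `b`, the central term of the normal equation pairs with `r` itself, so `‖r‖²`
  -- equals the sum of the terms with `j ≠ 0`.
  set b := T.symm r with hb
  have hTb : T b = r := T.apply_symm_apply r
  have hbn : ‖b‖ ≤ ‖(T.symm : H →L[ℂ] K)‖ * ‖r‖ := (T.symm : H →L[ℂ] K).le_opNorm r
  have hsum := hasSum_inner_gram hV hΦ b a
  have e1 : inner ℂ r r = ∑' j : {j : ℤ // j ≠ 0}, inner ℂ (V j b) (Φ j (V j a)) := by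
    have := tsum_eq_zero_add_tsum_ne hsum.summable
    rw [hsum.tsum_eq, ha, ContinuousLinearMap.adjoint_inner_right, hV0, hV0,
      ContinuousLinearEquiv.coe_coe, hTb] at this
    rw [← sub_eq_iff_eq_add'.2 this, ← inner_sub_right]
  have hs2 : Summable fun j : {j : ℤ // j ≠ 0} => ‖Φ j (V j a)‖ := by
    refine Summable.of_nonneg_of_le (fun _ => norm_nonneg _)
      (fun j => norm_apply_apply_le hV j a) (Summable.mul_right _ (hΦ.subtype _))
  have h3 : ‖r‖ ^ 2 ≤ ∑' j : {j : ℤ // j ≠ 0}, B * ‖b‖ * ‖Φ j (V j a)‖ := by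
    have : ‖r‖ ^ 2 = ‖inner ℂ r r‖ := by
      rw [inner_self_eq_norm_sq_to_K]; simp
    rw [this, e1]
    refine tsum_of_norm_bounded (hs2.mul_left _).hasSum fun j => ?_
    refine (norm_inner_le_norm _ _).trans ?_
    gcongr
    exact (V j).le_of_opNorm_le (hV j) b
  rw [tsum_mul_left] at h3
  have h4 := tail_le (T := T) hV hΦ a
  have hS : 0 ≤ ∑' j : {j : ℤ // j ≠ 0}, ‖Φ j‖ := tsum_nonneg fun _ => norm_nonneg _
  have h5 : ‖r‖ * ‖r‖ ≤ ((B * ‖(T.symm : H →L[ℂ] K)‖) ^ 2 *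
      (∑' j : {j : ℤ // j ≠ 0}, ‖Φ j‖) * ‖T a‖) * ‖r‖ := by
    calc ‖r‖ * ‖r‖ ≤ B * ‖b‖ * ∑' j : {j : ℤ // j ≠ 0}, ‖Φ j (V j a)‖ := by rw [← sq]; exact h3
      _ ≤ B * (‖(T.symm : H →L[ℂ] K)‖ * ‖r‖) *
          (B * ‖(T.symm : H →L[ℂ] K)‖ * (∑' j : {j : ℤ // j ≠ 0}, ‖Φ j‖) * ‖T a‖) := by gcongr
      _ = _ := by ring
  rcases (norm_nonneg r).eq_or_lt with h0 | h0
  · rw [← h0]; positivity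
  · exact le_of_mul_le_mul_right h5 h0

end Gram

/-! ### Multiplication operators and the symbols of an interpolator. -/

/-- Multiplication by a bounded function on `L²([-π, π])`. -/
def mulOp (g : ℝ → ℂ) (hg : MemLp g ∞ muPi) : L2Pi →L[ℂ] L2Pi :=
  (ContinuousLinearMap.mul ℂ ℂ).holderL muPi ∞ 2 2 hg.toLp

theorem coeFn_mulOp {g : ℝ → ℂ} (hg : MemLp g ∞ muPi) (h : L2Pi) :
    (mulOp g hg h : ℝ → ℂ) =ᵐ[muPi] fun ξ => g ξ * h ξ := by
  filter_upwards [(ContinuousLinearMap.mul ℂ ℂ).coeFn_holder (r := 2) hg.toLp h, hg.coeFn_toLp]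
    with ξ h1 h2
  refine h1.trans ?_
  rw [h2, ContinuousLinearMap.mul_apply']

theorem norm_mulOp_le {g : ℝ → ℂ} (hg : MemLp g ∞ muPi) {M : ℝ} (hM : 0 ≤ M)
    (hb : ∀ ξ ∈ Icc (-Real.pi) Real.pi, ‖g ξ‖ ≤ M) : ‖mulOp g hg‖ ≤ M := by
  refine ContinuousLinearMap.opNorm_le_bound _ hM fun h => ?_
  refine Lp.norm_le_mul_norm_of_ae_le_mul ?_
  have hmem : ∀ᵐ ξ ∂muPi, ξ ∈ Icc (-Real.pi) Real.pi := ae_restrict_mem measurableSet_Icc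
  filter_upwards [coeFn_mulOp hg h, hmem] with ξ h1 h2
  rw [h1, norm_mul]
  exact mul_le_mul_of_nonneg_right (hb ξ h2) (norm_nonneg _)

theorem re_inner_mulOp {w : ℝ → ℝ} (hg : MemLp (fun ξ => (w ξ : ℂ)) ∞ muPi) (h : L2Pi) :
    (inner ℂ h (mulOp _ hg h)).re = ∫ ξ, w ξ * ‖h ξ‖ ^ 2 ∂muPi := by
  have : inner ℂ h (mulOp _ hg h) = ∫ ξ, ((w ξ * ‖h ξ‖ ^ 2 : ℝ) : ℂ) ∂muPi := by
    rw [L2.inner_def]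
    refine integral_congr_ae ?_
    filter_upwards [coeFn_mulOp hg h] with ξ h1
    rw [h1, RCLike.inner_apply, mul_assoc, Complex.mul_conj, Complex.normSq_eq_norm_sq]
    push_cast
    ring
  rw [this, integral_complex_ofReal, Complex.ofReal_re]

section Interpolator

variable {φ : ℝ → ℝ}

theorem fourierL1_eq (φ : ℝ → ℝ) (ξ : ℝ) :
    fourierL1 φ ξ = normConst * 𝓕 (fun x => (φ x : ℂ)) (ξ / (2 * Real.pi)) := by
  rw [fourierL1, Real.fourier_eq']
  congr 1
  refine integral_congr_ae (Eventually.of_forall fun x => ?_)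
  simp only [smul_eq_mul, RCLike.inner_apply, conj_trivial]
  rw [mul_comm]
  congr 2
  push_cast
  field_simp

theorem continuous_fourierL1 (hφ : Integrable φ) : Continuous (fourierL1 φ) := by
  have h : Continuous (𝓕 fun x => (φ x : ℂ)) :=
    VectorFourier.fourierIntegral_continuous Real.continuous_fourierChar
      continuous_inner hφ.ofReal
  rw [funext (fourierL1_eq φ)]
  exact continuous_const.mul (h.comp (by fun_prop))

theorem norm_fourierL1_le (φ : ℝ → ℝ) (ξ : ℝ) :
    ‖fourierL1 φ ξ‖ ≤ ‖normConst‖ * ∫ x, ‖φ x‖ := by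
  rw [fourierL1, norm_mul]
  refine mul_le_mul_of_nonneg_left ((norm_integral_le_integral_norm _).trans (le_of_eq ?_))
    (norm_nonneg _)
  refine integral_congr_ae (Eventually.of_forall fun x => ?_)
  have : -(Complex.I * (x : ℂ) * (ξ : ℂ)) = ((-(x * ξ) : ℝ) : ℂ) * Complex.I := by
    push_cast; ring
  simp only [norm_mul]
  rw [this, Complex.norm_exp_ofReal_mul_I, Complex.norm_real, mul_one]

/-- The Fourier inversion formula for an interpolator. -/
theorem IsInterpolator.inversion (hφ : IsInterpolator φ) (t : ℝ) :
    (φ t : ℂ) =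
      normConst * ∫ ξ : ℝ, fourierL1 φ ξ * Complex.exp (Complex.I * (t : ℂ) * (ξ : ℂ)) := by
  have h1 : (𝓕 fun x => (φ x : ℂ)) = fun η : ℝ =>
      ((Real.sqrt (2 * Real.pi) : ℝ) : ℂ) * fourierL1 φ (2 * Real.pi * η) := by
    ext η
    rw [fourierL1_eq, ← mul_assoc, mul_comm _ normConst, normConst_mul_sqrt, one_mul,
      mul_div_cancel_left₀ _ (by positivity)]
  have hint : Integrable (𝓕 fun x => (φ x : ℂ)) := by
    rw [h1]
    exact (hφ.integrable_fourier.comp_mul_left' (by positivity)).const_mul _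
  have h2 := congrFun (Continuous.fourierInv_fourier_eq (f := fun x => (φ x : ℂ))
    (Complex.continuous_ofReal.comp hφ.continuous) hφ.integrable.ofReal hint) t
  rw [← fourierInv_rescale, ← h1, h2]

/-- The real part of the Fourier transform of `φ` on the cell `[-π, π] + 2πj`. -/
def symbol (φ : ℝ → ℝ) (j : ℤ) (ξ : ℝ) : ℝ := (fourierL1 φ (ξ + 2 * Real.pi * j)).re

theorem IsInterpolator.ofReal_symbol (hφ : IsInterpolator φ) (j : ℤ) (ξ : ℝ) :
    (symbol φ j ξ : ℂ) = fourierL1 φ (ξ + 2 * Real.pi * j) :=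
  Complex.ext (by simp [symbol]) (by simp [hφ.fourier_real])

theorem symbol_zero (φ : ℝ → ℝ) (ξ : ℝ) : symbol φ 0 ξ = (fourierL1 φ ξ).re := by
  simp [symbol]

theorem IsInterpolator.symbol_nonneg (hφ : IsInterpolator φ) (j : ℤ) (ξ : ℝ) :
    0 ≤ symbol φ j ξ := hφ.fourier_nonneg _

theorem symbol_le_bigM (φ : ℝ → ℝ) (j : ℤ) {ξ : ℝ} (hξ : ξ ∈ Icc (-Real.pi) Real.pi) :
    symbol φ j ξ ≤ bigM φ j := by
  refine le_csSup ⟨‖normConst‖ * ∫ x, ‖φ x‖, ?_⟩ ⟨ξ, hξ, rfl⟩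
  rintro _ ⟨η, -, rfl⟩
  exact (Complex.re_le_norm _).trans (norm_fourierL1_le φ _)

theorem zero_mem_Icc_pi : (0 : ℝ) ∈ Icc (-Real.pi) Real.pi :=
  ⟨by linarith [Real.pi_pos], Real.pi_pos.le⟩

theorem IsInterpolator.bigM_nonneg (hφ : IsInterpolator φ) (j : ℤ) : 0 ≤ bigM φ j :=
  (hφ.symbol_nonneg j 0).trans (symbol_le_bigM φ j zero_mem_Icc_pi)

theorem IsInterpolator.smallM_pos (hφ : IsInterpolator φ) : 0 < smallM φ := by
  obtain ⟨δ, hδ, h⟩ := hφ.fourier_pos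
  refine hδ.trans_le (le_csInf ⟨_, 0, zero_mem_Icc_pi, rfl⟩ ?_)
  rintro _ ⟨η, hη, rfl⟩
  exact h η hη

theorem IsInterpolator.smallM_le (hφ : IsInterpolator φ) {ξ : ℝ}
    (hξ : ξ ∈ Icc (-Real.pi) Real.pi) : smallM φ ≤ symbol φ 0 ξ := by
  rw [symbol_zero]
  refine csInf_le ⟨0, ?_⟩ ⟨ξ, hξ, rfl⟩
  rintro _ ⟨η, -, rfl⟩
  exact hφ.fourier_nonneg η

theorem IsInterpolator.continuous_symbol (hφ : IsInterpolator φ) (j : ℤ) :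
    Continuous (symbol φ j) :=
  Complex.continuous_re.comp ((continuous_fourierL1 hφ.integrable).comp (by fun_prop))

theorem IsInterpolator.norm_symbol_le (hφ : IsInterpolator φ) (j : ℤ) {ξ : ℝ}
    (hξ : ξ ∈ Icc (-Real.pi) Real.pi) : ‖(symbol φ j ξ : ℂ)‖ ≤ bigM φ j := by
  rw [Complex.norm_real, Real.norm_of_nonneg (hφ.symbol_nonneg j ξ)]
  exact symbol_le_bigM φ j hξ

theorem ae_mem_Icc_pi : ∀ᵐ ξ ∂muPi, ξ ∈ Icc (-Real.pi) Real.pi :=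
  ae_restrict_mem measurableSet_Icc

theorem IsInterpolator.memLp_symbol (hφ : IsInterpolator φ) (j : ℤ) :
    MemLp (fun ξ => (symbol φ j ξ : ℂ)) ∞ muPi :=
  memLp_top_of_bound
    (Complex.continuous_ofReal.comp (hφ.continuous_symbol j)).aestronglyMeasurable (bigM φ j) (by
      filter_upwards [ae_mem_Icc_pi] with ξ hξ
      exact hφ.norm_symbol_le j hξ)

/-- Multiplication by the Fourier transform of `φ` on the cell `[-π, π] + 2πj`. -/
def IsInterpolator.symbolOp (hφ : IsInterpolator φ) (j : ℤ) : L2Pi →L[ℂ] L2Pi :=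
  mulOp _ (hφ.memLp_symbol j)

theorem IsInterpolator.norm_symbolOp_le (hφ : IsInterpolator φ) (j : ℤ) :
    ‖hφ.symbolOp j‖ ≤ bigM φ j :=
  norm_mulOp_le _ (hφ.bigM_nonneg j) fun _ hξ => hφ.norm_symbol_le j hξ

theorem IsInterpolator.summable_norm_symbolOp (hφ : IsInterpolator φ) :
    Summable fun j => ‖hφ.symbolOp j‖ :=
  Summable.of_nonneg_of_le (fun _ => norm_nonneg _) hφ.norm_symbolOp_le hφ.summable_bigM

theorem IsInterpolator.tsum_norm_symbolOp_le (hφ : IsInterpolator φ) :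
    ∑' j : {j : ℤ // j ≠ 0}, ‖hφ.symbolOp j‖ ≤ ∑' j : {j : ℤ // j ≠ 0}, bigM φ j :=
  (hφ.summable_norm_symbolOp.subtype _).tsum_le_tsum (fun j => hφ.norm_symbolOp_le j)
    (hφ.summable_bigM.subtype _)

theorem IsInterpolator.re_inner_symbolOp (hφ : IsInterpolator φ) (j : ℤ) (h : L2Pi) :
    (inner ℂ h (hφ.symbolOp j h)).re = ∫ ξ, symbol φ j ξ * ‖h ξ‖ ^ 2 ∂muPi :=
  re_inner_mulOp _ h

theorem IsInterpolator.re_inner_symbolOp_nonneg (hφ : IsInterpolator φ) (j : ℤ) (h : L2Pi) :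
    0 ≤ (inner ℂ h (hφ.symbolOp j h)).re := by
  rw [hφ.re_inner_symbolOp]
  exact integral_nonneg fun ξ => mul_nonneg (hφ.symbol_nonneg j ξ) (sq_nonneg _)

theorem integrable_norm_sq (h : L2Pi) : Integrable (fun ξ => ‖h ξ‖ ^ 2) muPi :=
  (memLp_two_iff_integrable_sq_norm (Lp.memLp h).1).1 (Lp.memLp h)

theorem norm_sq_eq_integral (h : L2Pi) : ‖h‖ ^ 2 = ∫ ξ, ‖h ξ‖ ^ 2 ∂muPi := by
  have h1 : (inner ℂ h h : ℂ) = ((∫ ξ, ‖h ξ‖ ^ 2 ∂muPi : ℝ) : ℂ) := by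
    rw [L2.inner_def, ← integral_complex_ofReal]
    refine integral_congr_ae (Eventually.of_forall fun ξ => ?_)
    simp
  rw [← inner_self_eq_norm_sq (𝕜 := ℂ) h, h1]
  exact Complex.ofReal_re _

theorem IsInterpolator.integrable_symbol_mul (hφ : IsInterpolator φ) (j : ℤ) (h : L2Pi) :
    Integrable (fun ξ => symbol φ j ξ * ‖h ξ‖ ^ 2) muPi := by
  refine (integrable_norm_sq h).bdd_mul (c := bigM φ j)
    (hφ.continuous_symbol j).aestronglyMeasurable ?_
  filter_upwards [ae_mem_Icc_pi] with ξ hξ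
  rw [Real.norm_of_nonneg (hφ.symbol_nonneg j ξ)]
  exact symbol_le_bigM φ j hξ

theorem IsInterpolator.smallM_mul_le (hφ : IsInterpolator φ) (h : L2Pi) :
    smallM φ * ‖h‖ ^ 2 ≤ (inner ℂ h (hφ.symbolOp 0 h)).re := by
  rw [hφ.re_inner_symbolOp, norm_sq_eq_integral, ← integral_const_mul]
  refine integral_mono_ae ((integrable_norm_sq h).const_mul _) (hφ.integrable_symbol_mul 0 h) ?_
  filter_upwards [ae_mem_Icc_pi] with ξ hξ
  exact mul_le_mul_of_nonneg_right (hφ.smallM_le hξ) (sq_nonneg _)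

end Interpolator

/-! ### Shift series and the interpolation equation. -/

/-- The diagonal operator on `ℓ²(ℤ)` with unimodular entries `e^{-2πi j x_n}`. -/
def diagOp (x : ℤ → ℝ) (j : ℤ) : L2Seq →L[ℂ] L2Seq :=
  LinearMap.mkContinuous
    { toFun := fun a => ⟨fun n => character (-j) (x n) * a n,
        Memℓp.mono' (lp.memℓp a) fun n => by rw [norm_mul, norm_character, one_mul]⟩
      map_add' := fun a b => lp.ext (funext fun n => mul_add _ _ _)
      map_smul' := fun c a => lp.ext (funext fun n => mul_left_comm _ _ _) } 1
    fun a => by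
      rw [one_mul]
      refine lp.norm_mono (by norm_num) fun n => ?_
      exact (norm_mul _ _).le.trans (by rw [norm_character, one_mul])

theorem diagOp_apply (x : ℤ → ℝ) (j : ℤ) (a : L2Seq) (n : ℤ) :
    diagOp x j a n = character (-j) (x n) * a n := rfl

theorem norm_diagOp_le (x : ℤ → ℝ) (j : ℤ) : ‖diagOp x j‖ ≤ 1 :=
  LinearMap.mkContinuous_norm_le _ zero_le_one _

theorem character_zero (t : ℝ) : character 0 t = 1 := by simp [character]

theorem conj_character (m : ℤ) (t : ℝ) :
    (starRingEnd ℂ) (character m t) = character (-m) t := by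
  rw [character, character, ← Complex.exp_conj]
  simp [Complex.conj_ofNat]

theorem diagOp_zero (x : ℤ → ℝ) (a : L2Seq) : diagOp x 0 a = a := by
  apply lp.ext
  funext n
  rw [diagOp_apply, neg_zero, character_zero, one_mul]

theorem diagOp_single (x : ℤ → ℝ) (j n : ℤ) (z : ℂ) :
    diagOp x j (lp.single 2 n z) = character (-j) (x n) • lp.single 2 n z := by
  apply lp.ext
  funext k
  rw [diagOp_apply, lp.coeFn_smul, Pi.smul_apply, smul_eq_mul]
  rcases eq_or_ne k n with rfl | hk
  · rfl
  · rw [lp.single_apply_ne _ _ _ hk, mul_zero, mul_zero]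

section Series

variable {φ : ℝ → ℝ} {x : ℤ → ℝ} {T : L2Seq ≃L[ℂ] L2Pi}

/-- The synthesis operator of the exponentials `e^{-i x_n (ξ + 2πj)}`. -/
def shiftedSynthesis (T : L2Seq ≃L[ℂ] L2Pi) (x : ℤ → ℝ) (j : ℤ) : L2Seq →L[ℂ] L2Pi :=
  (T : L2Seq →L[ℂ] L2Pi) ∘L diagOp x j

theorem norm_shiftedSynthesis_le (T : L2Seq ≃L[ℂ] L2Pi) (x : ℤ → ℝ) (j : ℤ) :
    ‖shiftedSynthesis T x j‖ ≤ ‖(T : L2Seq →L[ℂ] L2Pi)‖ :=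
  (ContinuousLinearMap.opNorm_comp_le _ _).trans
    (mul_le_of_le_one_right (norm_nonneg _) (norm_diagOp_le x j))

theorem shiftedSynthesis_zero (T : L2Seq ≃L[ℂ] L2Pi) (x : ℤ → ℝ) (a : L2Seq) :
    shiftedSynthesis T x 0 a = T a := by
  simp [shiftedSynthesis, diagOp_zero]

theorem shiftedSynthesis_single (hT : ∀ n, T (lp.single 2 n 1) = expPi (x n)) (j n : ℤ) :
    shiftedSynthesis T x j (lp.single 2 n 1) = character (-j) (x n) • expPi (x n) := by
  simp [shiftedSynthesis, diagOp_single, hT]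

/-- The Fourier transform of `∑ aₙ φ(· - xₙ)` on the cell `[-π, π] + 2πj`. -/
def IsInterpolator.seriesCell (hφ : IsInterpolator φ) (T : L2Seq ≃L[ℂ] L2Pi) (x : ℤ → ℝ)
    (a : L2Seq) (j : ℤ) : L2Pi := hφ.symbolOp j (shiftedSynthesis T x j a)

theorem IsInterpolator.norm_seriesCell_le (hφ : IsInterpolator φ) (T : L2Seq ≃L[ℂ] L2Pi)
    (x : ℤ → ℝ) (a : L2Seq) (j : ℤ) :
    ‖hφ.seriesCell T x a j‖ ≤ ‖hφ.symbolOp j‖ * (‖(T : L2Seq →L[ℂ] L2Pi)‖ * ‖a‖) :=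
  norm_apply_apply_le (norm_shiftedSynthesis_le T x) j a

theorem IsInterpolator.summable_norm_seriesCell (hφ : IsInterpolator φ) (T : L2Seq ≃L[ℂ] L2Pi)
    (x : ℤ → ℝ) (a : L2Seq) : Summable fun j => ‖hφ.seriesCell T x a j‖ :=
  Summable.of_nonneg_of_le (fun _ => norm_nonneg _) (hφ.norm_seriesCell_le T x a)
    (hφ.summable_norm_symbolOp.mul_right _)

/-- Fourier inversion for `φ` at `t - x n`, with the integral split over cells; the phase `e^{-i x_n
(ξ + 2πj)}` splits into a character and an exponential on the central cell. -/
theorem IsInterpolator.synth_single (hφ : IsInterpolator φ)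
    (hT : ∀ n, T (lp.single 2 n 1) = expPi (x n)) (t : ℝ) (n : ℤ) :
    synth (hφ.seriesCell T x (lp.single 2 n 1)) t = φ (t - x n) := by
  have hint : Integrable fun ξ : ℝ =>
      fourierL1 φ ξ * Complex.exp (Complex.I * ((t - x n : ℝ) : ℂ) * (ξ : ℂ)) := by
    refine hφ.integrable_fourier.mul_bdd (c := 1)
      (Continuous.aestronglyMeasurable (by fun_prop)) (Eventually.of_forall fun ξ => ?_)
    have : Complex.I * ((t - x n : ℝ) : ℂ) * (ξ : ℂ)
        = (((t - x n) * ξ : ℝ) : ℂ) * Complex.I := by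
      push_cast; ring
    rw [this, Complex.norm_exp_ofReal_mul_I]
  have hs := ((hasSum_integral_muPi hint).mul_left normConst).tsum_eq
  rw [hφ.inversion, ← hs, synth]
  refine tsum_congr fun j => ?_
  rw [IsInterpolator.seriesCell, shiftedSynthesis_single hT, map_smul, map_smul, evalPi_apply,
    smul_eq_mul, mul_left_comm, mul_left_comm (character j t), mul_left_comm (character (-j) (x n)),
    ← integral_const_mul (character j t),
    ← integral_const_mul (character (-j) (x n))]
  refine congrArg (normConst * ·) (integral_congr_ae ?_)
  filter_upwards [coeFn_mulOp (hφ.memLp_symbol j) (expPi (x n)), coeFn_expPi (x n)] with ξ h1 h2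
  rw [IsInterpolator.symbolOp, h1, h2, hφ.ofReal_symbol, character, character]
  have e : Complex.exp (Complex.I * ((t - x n : ℝ) : ℂ) * ((ξ + 2 * Real.pi * j : ℝ) : ℂ)) =
      Complex.exp (2 * (Real.pi : ℂ) * Complex.I * ((-j : ℤ) : ℂ) * (x n : ℂ)) *
      Complex.exp (2 * (Real.pi : ℂ) * Complex.I * (j : ℂ) * (t : ℂ)) *
      Complex.exp (-(Complex.I * (x n : ℂ) * (ξ : ℂ))) *
      Complex.exp (Complex.I * (t : ℂ) * (ξ : ℂ)) := by
    rw [← Complex.exp_add, ← Complex.exp_add, ← Complex.exp_add]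
    congr 1
    push_cast
    ring
  rw [e]
  ring

/-- The shift series converges to the function with the expected Fourier transform. -/
theorem IsInterpolator.hasSum_shiftSeries (hφ : IsInterpolator φ)
    (hT : ∀ n, T (lp.single 2 n 1) = expPi (x n)) (a : L2Seq) (t : ℝ) :
    HasSum (fun n => a n * (φ (t - x n) : ℂ)) (synth (hφ.seriesCell T x a) t) := by
  -- For fixed `t`, synthesis is one bounded functional of `a`, the norm-convergent sum of the `L
  -- j`. Applying it to the basis expansion of `a` reduces the claim to `synth_single`.
  set L : ℤ → L2Seq →L[ℂ] ℂ := fun j =>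
    character j t • (evalPi t ∘L hφ.symbolOp j ∘L shiftedSynthesis T x j) with hL
  have hsum : Summable L := by
    refine Summable.of_norm_bounded
      (hφ.summable_norm_symbolOp.mul_right ‖(T : L2Seq →L[ℂ] L2Pi)‖) fun j => ?_
    refine ContinuousLinearMap.opNorm_le_bound _ (by positivity) fun a => ?_
    refine (norm_character_mul_evalPi_le j t _).trans ((hφ.norm_seriesCell_le T x a j).trans ?_)
    rw [mul_assoc]
  have hLa : ∀ a, (∑' j, L j) a = synth (hφ.seriesCell T x a) t := fun a =>
    (hsum.hasSum.mapL (ContinuousLinearMap.apply ℂ ℂ a)).tsum_eq.symm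
  have h := (lp.hasSum_single (p := 2) (by norm_num) a).mapL (∑' j, L j)
  rw [hLa] at h
  convert! h using 2 with n
  have : lp.single 2 n (a n) = a n • (lp.single 2 n 1 : L2Seq) := by
    rw [← lp.single_smul, smul_eq_mul, mul_one]
  rw [this, map_smul, hLa, hφ.synth_single hT, smul_eq_mul]

theorem IsInterpolator.shiftSeries_eq (hφ : IsInterpolator φ)
    (hT : ∀ n, T (lp.single 2 n 1) = expPi (x n)) (a : L2Seq) (t : ℝ) :
    shiftSeries φ x a t = synth (hφ.seriesCell T x a) t :=
  (hφ.hasSum_shiftSeries hT a t).tsum_eq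

/-- Interpolation is the normal equation for the Gram operator. -/
theorem IsInterpolator.interpolates_iff (hφ : IsInterpolator φ)
    (hT : ∀ n, T (lp.single 2 n 1) = expPi (x n)) (f : L2R) (m : ℤ) (a : L2Seq) :
    Interpolates φ x (piece f m) a ↔
      gram (shiftedSynthesis T x) hφ.symbolOp a =
        ContinuousLinearMap.adjoint (T : L2Seq →L[ℂ] L2Pi) (cellPart f m) := by
  have hin : ∀ (b : L2Seq) (k : ℤ), inner ℂ (lp.single 2 k (1 : ℂ) : L2Seq) b = b k := fun b k => by
    rw [lp.inner_single_left]; simp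
  have h1 : ∀ k, shiftSeries φ x a (x k) =
      normConst * gram (shiftedSynthesis T x) hφ.symbolOp a k := fun k => by
    rw [hφ.shiftSeries_eq hT, ← hin, ← ((hasSum_inner_gram (norm_shiftedSynthesis_le T x)
      hφ.summable_norm_symbolOp (lp.single 2 k 1) a).mul_left normConst).tsum_eq, synth]
    refine tsum_congr fun j => ?_
    rw [shiftedSynthesis_single hT, inner_smul_left, conj_character, neg_neg, evalPi_apply_inner,
      mul_left_comm]
    rfl
  have h2 : ∀ k, piece f m (x k) =
      normConst * ContinuousLinearMap.adjoint (T : L2Seq →L[ℂ] L2Pi) (cellPart f m) k := fun k => by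
    rw [piece_eq_evalPi, evalPi_apply_inner, ← hin, ContinuousLinearMap.adjoint_inner_right,
      ContinuousLinearEquiv.coe_coe, hT]
  simp only [Interpolates, h1, h2, mul_right_inj' normConst_ne_zero]
  exact ⟨fun h => lp.ext (funext h), fun h k => by rw [h]⟩

theorem IsInterpolator.existsUnique_interpolates (hφ : IsInterpolator φ)
    (hT : ∀ n, T (lp.single 2 n 1) = expPi (x n)) (f : L2R) (m : ℤ) :
    ∃! a : L2Seq, Interpolates φ x (piece f m) a := by
  simp only [hφ.interpolates_iff hT]
  exact (bijective_gram (norm_shiftedSynthesis_le T x) hφ.summable_norm_symbolOp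
    hφ.re_inner_symbolOp_nonneg (shiftedSynthesis_zero T x) hφ.smallM_pos
    hφ.smallM_mul_le).existsUnique _

end Series

/-! ### The energy estimate and the error for a single piece. -/

section Energy

variable {φ : ℝ → ℝ} {x : ℤ → ℝ} {T : L2Seq ≃L[ℂ] L2Pi}

/-- The weighted norm `∫ |h|² m / φ̂` over `[-π, π]`, where `m` is the minimum of `φ̂` there. -/
def weightedSq (φ : ℝ → ℝ) (h : L2Pi) : ℝ :=
  ∫ ξ, smallM φ / (fourierL1 φ ξ).re * ‖h ξ‖ ^ 2 ∂muPi

theorem IsInterpolator.ratio_mem_Icc (hφ : IsInterpolator φ) {ξ : ℝ}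
    (hξ : ξ ∈ Icc (-Real.pi) Real.pi) : smallM φ / (fourierL1 φ ξ).re ∈ Icc (0 : ℝ) 1 := by
  have h := hφ.smallM_le hξ
  rw [symbol_zero] at h
  have h0 := hφ.smallM_pos
  exact ⟨div_nonneg h0.le (h0.le.trans h), div_le_one_of_le₀ h (h0.le.trans h)⟩

theorem IsInterpolator.aestronglyMeasurable_ratio (hφ : IsInterpolator φ) :
    AEStronglyMeasurable (fun ξ => smallM φ / (fourierL1 φ ξ).re) muPi :=
  (measurable_const.div (Complex.continuous_re.comp
    (continuous_fourierL1 hφ.integrable)).measurable).aestronglyMeasurable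

theorem IsInterpolator.integrable_weighted (hφ : IsInterpolator φ) (h : L2Pi) :
    Integrable (fun ξ => smallM φ / (fourierL1 φ ξ).re * ‖h ξ‖ ^ 2) muPi := by
  refine (integrable_norm_sq h).bdd_mul (c := 1) hφ.aestronglyMeasurable_ratio ?_
  filter_upwards [ae_mem_Icc_pi] with ξ hξ
  rw [Real.norm_of_nonneg (hφ.ratio_mem_Icc hξ).1]
  exact (hφ.ratio_mem_Icc hξ).2

theorem IsInterpolator.weightedSq_le (hφ : IsInterpolator φ) (h : L2Pi) :
    weightedSq φ h ≤ ‖h‖ ^ 2 := by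
  rw [norm_sq_eq_integral]
  refine integral_mono_ae (hφ.integrable_weighted h) (integrable_norm_sq h) ?_
  filter_upwards [ae_mem_Icc_pi] with ξ hξ
  exact mul_le_of_le_one_left (sq_nonneg _) (hφ.ratio_mem_Icc hξ).2

theorem IsInterpolator.sqrt_weightedSq_le (hφ : IsInterpolator φ) (h : L2Pi) :
    Real.sqrt (weightedSq φ h) ≤ ‖h‖ :=
  Real.sqrt_le_iff.2 ⟨norm_nonneg h, hφ.weightedSq_le h⟩

/-- Dominated convergence: the ratio `m_α / φ̂_α` lies in `[0, 1]` on the cell, so `|h|²` is a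
majorant. -/
theorem IsRegularFamily.tendsto_weightedSq {A : Set ℝ} {φ : ℝ → ℝ → ℝ}
    (hφ : IsRegularFamily A φ) (h : L2Pi) :
    Tendsto (fun α => weightedSq (φ α) h) (atTop ⊓ 𝓟 A) (𝓝 0) := by
  have hA : ∀ᶠ α in atTop ⊓ 𝓟 A, α ∈ A := mem_inf_of_right (mem_principal_self A)
  have key := tendsto_integral_filter_of_dominated_convergence (μ := muPi) (l := atTop ⊓ 𝓟 A)
    (F := fun α ξ => smallM (φ α) / (fourierL1 (φ α) ξ).re * ‖h ξ‖ ^ 2)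
    (f := fun _ => (0 : ℝ)) (fun ξ => ‖h ξ‖ ^ 2) ?_ ?_ (integrable_norm_sq h) ?_
  · rwa [integral_zero] at key
  · filter_upwards [hA] with α hα
    exact ((hφ.interpolator α hα).integrable_weighted h).aestronglyMeasurable
  · filter_upwards [hA] with α hα
    filter_upwards [ae_mem_Icc_pi] with ξ hξ
    have hr := (hφ.interpolator α hα).ratio_mem_Icc hξ
    rw [Real.norm_of_nonneg (mul_nonneg hr.1 (sq_nonneg _))]
    exact mul_le_of_le_one_left (sq_nonneg _) hr.2
  · filter_upwards [hφ.ratio_tendsto] with ξ hξ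
    simpa using hξ.mul_const (‖h ξ‖ ^ 2)

/-- The energy estimate for a function `u` dominated in the sense of the normal equation. -/
theorem IsInterpolator.smallM_mul_norm_le (hφ : IsInterpolator φ) {u h : L2Pi}
    (huh : (inner ℂ u (hφ.symbolOp 0 u)).re ≤ (inner ℂ u h).re) :
    smallM φ * ‖u‖ ≤ Real.sqrt (weightedSq φ h) := by
  have hm := hφ.smallM_pos
  set I := ∫ ξ, symbol φ 0 ξ * ‖u ξ‖ ^ 2 ∂muPi with hI
  have h1 : I ≤ (inner ℂ u h).re := by rwa [hφ.re_inner_symbolOp] at huh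
  have h2 : smallM φ * ‖u‖ ^ 2 ≤ I := (hφ.smallM_mul_le u).trans (hφ.re_inner_symbolOp 0 u).le
  have hi1 := hφ.integrable_symbol_mul 0 u
  have hi2 := hφ.integrable_weighted h
  have h3 : (inner ℂ u h).re ≤ 2⁻¹ * (I + (smallM φ)⁻¹ * weightedSq φ h) := by
    refine (Complex.re_le_norm _).trans ?_
    rw [L2.inner_def, hI, weightedSq, ← integral_const_mul, ← integral_add hi1 (hi2.const_mul _),
      ← integral_const_mul]
    refine norm_integral_le_of_norm_le ((hi1.add (hi2.const_mul _)).const_mul _) ?_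
    filter_upwards [ae_mem_Icc_pi] with ξ hξ
    have hw : 0 < symbol φ 0 ξ := hm.trans_le (hφ.smallM_le hξ)
    refine (norm_inner_le_norm _ _).trans ?_
    rw [← symbol_zero φ ξ]
    -- With `w` the symbol, `2|u||h| ≤ w|u|² + |h|²/w`. The resulting `I/2` is then absorbed into `I
    -- ≤ Re⟨u, h⟩`.
    have e : symbol φ 0 ξ * ‖u ξ‖ ^ 2 +
        (smallM φ)⁻¹ * (smallM φ / symbol φ 0 ξ * ‖h ξ‖ ^ 2) - 2 * (‖u ξ‖ * ‖h ξ‖) =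
        (symbol φ 0 ξ * ‖u ξ‖ - ‖h ξ‖) ^ 2 / symbol φ 0 ξ := by
      field_simp
      ring
    have : 0 ≤ (symbol φ 0 ξ * ‖u ξ‖ - ‖h ξ‖) ^ 2 / symbol φ 0 ξ := by positivity
    linarith
  have h4 : I ≤ (smallM φ)⁻¹ * weightedSq φ h := by linarith
  refine Real.le_sqrt_of_sq_le ?_
  calc (smallM φ * ‖u‖) ^ 2 = smallM φ * (smallM φ * ‖u‖ ^ 2) := by ring
    _ ≤ smallM φ * ((smallM φ)⁻¹ * weightedSq φ h) := mul_le_mul_of_nonneg_left (h2.trans h4) hm.le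
    _ = weightedSq φ h := by rw [← mul_assoc, mul_inv_cancel₀ hm.ne', one_mul]

/-- The difference, cell by cell, between a function with Fourier transform `h` on `[-π, π]` and
the shift series with coefficients `a`. -/
def IsInterpolator.errorCell (hφ : IsInterpolator φ) (T : L2Seq ≃L[ℂ] L2Pi) (x : ℤ → ℝ)
    (h : L2Pi) (a : L2Seq) (j : ℤ) : L2Pi :=
  (if j = 0 then h else 0) - hφ.seriesCell T x a j

theorem IsInterpolator.summable_norm_errorCell (hφ : IsInterpolator φ) (T : L2Seq ≃L[ℂ] L2Pi)
    (x : ℤ → ℝ) (h : L2Pi) (a : L2Seq) : Summable fun j => ‖hφ.errorCell T x h a j‖ := by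
  have h1 : Summable fun j : ℤ => ‖if j = 0 then h else 0‖ :=
    summable_of_ne_finset_zero (s := {0}) fun j hj => by
      rw [if_neg (by simpa using hj), norm_zero]
  exact Summable.of_nonneg_of_le (fun _ => norm_nonneg _) (fun j => norm_sub_le _ _)
    (h1.add (hφ.summable_norm_seriesCell T x a))

theorem synth_ite (h : L2Pi) (t : ℝ) : synth (fun j => if j = 0 then h else 0) t = evalPi t h := by
  rw [synth, tsum_eq_single 0 fun j hj => by rw [if_neg hj, map_zero, mul_zero]]
  simp [character_zero]

theorem IsInterpolator.synth_errorCell (hφ : IsInterpolator φ) (T : L2Seq ≃L[ℂ] L2Pi)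
    (x : ℤ → ℝ) (h : L2Pi) (a : L2Seq) (t : ℝ) :
    synth (hφ.errorCell T x h a) t = evalPi t h - synth (hφ.seriesCell T x a) t := by
  have h1 : Summable fun j : ℤ => ‖if j = 0 then h else 0‖ :=
    summable_of_ne_finset_zero (s := {0}) fun j hj => by
      rw [if_neg (by simpa using hj), norm_zero]
  rw [← synth_ite h t, ← synth_sub h1 (hφ.summable_norm_seriesCell T x a)]
  rfl

/-- The constant in the error estimate; it depends only on the Riesz basis and on the constant
of the regular family. -/
def errorConst (T : L2Seq ≃L[ℂ] L2Pi) (C : ℝ) : ℝ :=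
  ((‖(T : L2Seq →L[ℂ] L2Pi)‖ * ‖(T.symm : L2Pi →L[ℂ] L2Seq)‖) ^ 2 +
    ‖(T : L2Seq →L[ℂ] L2Pi)‖ * ‖(T.symm : L2Pi →L[ℂ] L2Seq)‖) * |C|

theorem IsInterpolator.tsum_norm_errorCell_le (hφ : IsInterpolator φ) {C : ℝ}
    (hC : ∑' j : {j : ℤ // j ≠ 0}, bigM φ j ≤ C * smallM φ) {h : L2Pi} {a : L2Seq}
    (ha : gram (shiftedSynthesis T x) hφ.symbolOp a =
      ContinuousLinearMap.adjoint (T : L2Seq →L[ℂ] L2Pi) h) :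
    ∑' j, ‖hφ.errorCell T x h a j‖ ≤ errorConst T C * Real.sqrt (weightedSq φ h) := by
  have hV := norm_shiftedSynthesis_le T x
  have hV0 := shiftedSynthesis_zero T x
  have hS := hφ.summable_norm_symbolOp
  rw [tsum_eq_zero_add_tsum_ne (hφ.summable_norm_errorCell T x h a)]
  have e0 : hφ.errorCell T x h a 0 = h - hφ.symbolOp 0 (T a) := by
    rw [errorCell, if_pos rfl, seriesCell, hV0]
  have e1 : ∀ j : {j : ℤ // j ≠ 0},
      ‖hφ.errorCell T x h a j‖ = ‖hφ.symbolOp j (shiftedSynthesis T x j a)‖ := fun j => by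
    rw [errorCell, if_neg j.2, zero_sub, norm_neg, seriesCell]
  simp_rw [e0, e1]
  have h1 := residual_le hV hS hV0 ha
  have h2 := tail_le (T := T) hV hS a
  have h3 := hφ.smallM_mul_norm_le (re_inner_le_of_gram_eq hV hS hφ.re_inner_symbolOp_nonneg hV0 ha)
  have h4 : ∑' j : {j : ℤ // j ≠ 0}, ‖hφ.symbolOp j‖ ≤ |C| * smallM φ :=
    (hφ.tsum_norm_symbolOp_le.trans hC).trans
      (mul_le_mul_of_nonneg_right (le_abs_self C) hφ.smallM_pos.le)
  set κ := ‖(T : L2Seq →L[ℂ] L2Pi)‖ * ‖(T.symm : L2Pi →L[ℂ] L2Seq)‖ with hκ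
  have hκ0 : 0 ≤ κ := by positivity
  -- The term `κ²` comes from the residual on the central cell, `κ` from the outer cells.
  calc _ ≤ (κ ^ 2 + κ) * ((∑' j : {j : ℤ // j ≠ 0}, ‖hφ.symbolOp j‖) * ‖T a‖) := by linarith
    _ ≤ (κ ^ 2 + κ) * (|C| * smallM φ * ‖T a‖) := by gcongr
    _ = (κ ^ 2 + κ) * |C| * (smallM φ * ‖T a‖) := by ring
    _ ≤ errorConst T C * Real.sqrt (weightedSq φ h) := by
      rw [errorConst]
      gcongr

end Energy

/-! ### Summing the modulated pieces. -/

section Resummation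

/-- The shear `(l, m) ↦ (m, l - m)`. -/
def shear : ℤ × ℤ ≃ ℤ × ℤ where
  toFun p := (p.2, p.1 - p.2)
  invFun q := (q.1 + q.2, q.1)
  left_inv p := by ext <;> simp
  right_inv q := by ext <;> simp

variable {e : ℤ → ℤ → L2Pi}

theorem summable_shear (he : Summable fun p : ℤ × ℤ => ‖e p.1 p.2‖) :
    Summable fun p : ℤ × ℤ => ‖e p.2 (p.1 - p.2)‖ :=
  (shear.summable_iff (f := fun p : ℤ × ℤ => ‖e p.1 p.2‖)).2 he

/-- The superposition of the modulations by `e^{2πimt}` of the functions given by `e m`. -/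
def superpose (e : ℤ → ℤ → L2Pi) (l : ℤ) : L2Pi := ∑' m, e m (l - m)

theorem norm_superpose_le (he : Summable fun p : ℤ × ℤ => ‖e p.1 p.2‖) (l : ℤ) :
    ‖superpose e l‖ ≤ ∑' m, ‖e m (l - m)‖ :=
  norm_tsum_le_tsum_norm ((summable_shear he).prod_factor l)

theorem summable_norm_superpose (he : Summable fun p : ℤ × ℤ => ‖e p.1 p.2‖) :
    Summable fun l => ‖superpose e l‖ :=
  Summable.of_nonneg_of_le (fun _ => norm_nonneg _) (norm_superpose_le he) (summable_shear he).prod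

theorem tsum_norm_superpose_le (he : Summable fun p : ℤ × ℤ => ‖e p.1 p.2‖) :
    ∑' l, ‖superpose e l‖ ≤ ∑' m, ∑' j, ‖e m j‖ := by
  refine ((summable_norm_superpose he).tsum_le_tsum (norm_superpose_le he)
    (summable_shear he).prod).trans (le_of_eq ?_)
  rw [← he.tsum_prod, ← (summable_shear he).tsum_prod]
  exact shear.tsum_eq (fun p : ℤ × ℤ => ‖e p.1 p.2‖)

/-- Fubini on `ℤ × ℤ`: summing over `j` for fixed `m` gives the modulated pieces, summing over fixed
`l = m + j` gives the cells of the superposition. -/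
theorem hasSum_character_mul_synth (he : Summable fun p : ℤ × ℤ => ‖e p.1 p.2‖) (t : ℝ) :
    HasSum (fun m => character m t * synth (e m) t) (synth (superpose e) t) := by
  have h1 : Summable fun p : ℤ × ℤ => character (p.1 + p.2) t * evalPi t (e p.1 p.2) :=
    Summable.of_norm_bounded he fun p => norm_character_mul_evalPi_le _ t _
  have h2 : HasSum (fun m => character m t * synth (e m) t)
      (∑' p : ℤ × ℤ, character (p.1 + p.2) t * evalPi t (e p.1 p.2)) := by
    refine h1.hasSum.prod_fiberwise fun m => ?_
    have := (summable_synth (he.prod_factor m) t).hasSum.mul_left (character m t)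
    simpa only [character_add, mul_assoc] using! this
  convert! h2 using 1
  have h3 := (shear.summable_iff (f := fun p : ℤ × ℤ =>
    character (p.1 + p.2) t * evalPi t (e p.1 p.2))).2 h1
  refine Eq.trans ?_ (shear.tsum_eq _)
  refine Eq.trans ?_ h3.tsum_prod.symm
  refine tsum_congr fun l => ?_
  have h4 : Summable fun m => e m (l - m) := ((summable_shear he).prod_factor l).of_norm
  rw [superpose, (evalPi t).map_tsum h4, ← tsum_mul_left]
  refine tsum_congr fun m => ?_
  simp [shear]

end Resummation

/-! ### The total error and its limit. -/

/-- For each interpolator, the approximant is the function `f` minus a function whose amalgam norm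
is controlled by the weighted norms of the pieces of the Fourier transform of `f`. -/
theorem IsInterpolator.exists_error {φ : ℝ → ℝ} {x : ℤ → ℝ} {T : L2Seq ≃L[ℂ] L2Pi}
    (hφ : IsInterpolator φ) (hT : ∀ n, T (lp.single 2 n 1) = expPi (x n)) {C : ℝ}
    (hC : ∑' j : {j : ℤ // j ≠ 0}, bigM φ j ≤ C * smallM φ) {f : L2R}
    (hf : Summable fun m => ‖cellPart f m‖) {a : ℤ → L2Seq}
    (ha : ∀ m, Interpolates φ x (piece f m) (a m)) :
    ∃ d : ℤ → L2Pi, (Summable fun l => ‖d l‖) ∧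
      ∑' l, ‖d l‖ ≤ errorConst T C * ∑' m, Real.sqrt (weightedSq φ (cellPart f m)) ∧
      ∀ t, HasSum (fun m => character m t * shiftSeries φ x (a m) t)
        (synth (fun l => cellPart f l - d l) t) := by
  have hle : ∀ m, ∑' j, ‖hφ.errorCell T x (cellPart f m) (a m) j‖ ≤
      errorConst T C * Real.sqrt (weightedSq φ (cellPart f m)) := fun m =>
    hφ.tsum_norm_errorCell_le hC ((hφ.interpolates_iff hT f m (a m)).1 (ha m))
  have hsq : Summable fun m => errorConst T C * Real.sqrt (weightedSq φ (cellPart f m)) :=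
    (Summable.of_nonneg_of_le (fun _ => Real.sqrt_nonneg _)
      (fun m => hφ.sqrt_weightedSq_le (cellPart f m)) hf).mul_left _
  set e : ℤ → ℤ → L2Pi := fun m => hφ.errorCell T x (cellPart f m) (a m) with he_def
  have hnn : ∀ m, 0 ≤ ∑' j, ‖e m j‖ := fun m => tsum_nonneg fun _ => norm_nonneg _
  have hem : Summable fun m => ∑' j, ‖e m j‖ := Summable.of_nonneg_of_le hnn hle hsq
  have he : Summable fun p : ℤ × ℤ => ‖e p.1 p.2‖ :=
    (summable_prod_of_nonneg fun _ => norm_nonneg _).2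
      ⟨fun m => hφ.summable_norm_errorCell T x (cellPart f m) (a m), hem⟩
  refine ⟨superpose e, summable_norm_superpose he, ?_, fun t => ?_⟩
  · refine (tsum_norm_superpose_le he).trans ((hem.tsum_le_tsum hle hsq).trans (le_of_eq ?_))
    rw [tsum_mul_left]
  -- Each term is the modulated piece of `f` minus its modulated error; the first parts sum to the
  -- synthesis of `f`, the second to that of the superposition.
  · rw [synth_sub hf (summable_norm_superpose he)]
    have := (summable_synth hf t).hasSum.sub (hasSum_character_mul_synth he t)
    refine this.congr_fun fun m => ?_
    rw [he_def, hφ.synth_errorCell, hφ.shiftSeries_eq hT]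
    ring

/-- Dominated convergence for series, with the summable majorant `‖cellPart f m‖` that membership of
`f` in the amalgam space provides. -/
theorem IsRegularFamily.tendsto_tsum_sqrt_weightedSq {A : Set ℝ} {φ : ℝ → ℝ → ℝ}
    (hφ : IsRegularFamily A φ) {f : L2R} (hf : Summable fun m => ‖cellPart f m‖) :
    Tendsto (fun α => ∑' m, Real.sqrt (weightedSq (φ α) (cellPart f m))) (atTop ⊓ 𝓟 A)
      (𝓝 0) := by
  have hA : ∀ᶠ α in atTop ⊓ 𝓟 A, α ∈ A := mem_inf_of_right (mem_principal_self A)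
  have := tendsto_tsum_of_dominated_convergence
    (f := fun α m => Real.sqrt (weightedSq (φ α) (cellPart f m))) (g := fun _ => (0 : ℝ)) hf
    (fun m => by
      simpa using (hφ.tendsto_weightedSq (cellPart f m)).sqrt) (by
    filter_upwards [hA] with α hα m
    rw [Real.norm_of_nonneg (Real.sqrt_nonneg _)]
    exact (hφ.interpolator α hα).sqrt_weightedSq_le _)
  simpa using this

end

end PWAmalgam

open PWAmalgam in
theorem mainTheorem1 (f : PWAmalgam.L2R) (hf : PWAmalgam.MemPW f)
    (x : ℤ → ℝ) (hx : PWAmalgam.IsCompleteInterpolatingSeq x)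
    (A : Set ℝ) (φ : ℝ → ℝ → ℝ) (hφ : PWAmalgam.IsRegularFamily A φ) :
    -- the interpolants of the pieces exist, with unique square-summable coefficients
    (∀ α ∈ A, ∀ m : ℤ, ∃! a : PWAmalgam.L2Seq,
      PWAmalgam.Interpolates (φ α) x (PWAmalgam.piece f m) a) ∧
    -- and the approximants built from them are well defined and converge in all three senses
    ∀ a : ℝ → ℤ → PWAmalgam.L2Seq,
      (∀ α ∈ A, ∀ m : ℤ,
        PWAmalgam.Interpolates (φ α) x (PWAmalgam.piece f m) (a α m)) →
      (∀ α ∈ A, ∀ t : ℝ,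
        (∀ m : ℤ, Summable fun n : ℤ => a α m n * (φ α (t - x n) : ℂ)) ∧
        Summable fun m : ℤ =>
          Complex.exp (2 * (Real.pi : ℂ) * Complex.I * (m : ℂ) * (t : ℂ)) *
            PWAmalgam.shiftSeries (φ α) x (a α m) t) ∧
      (∃ J : ℝ → PWAmalgam.L2R,
        (∀ α ∈ A, (J α : ℝ → ℂ) =ᵐ[volume] PWAmalgam.approximant (φ α) x (a α)) ∧
        (∀ α ∈ A, PWAmalgam.MemPW (J α)) ∧
        Tendsto (fun α : ℝ => ‖f - J α‖) (atTop ⊓ 𝓟 A) (𝓝 0) ∧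
        Tendsto (fun α : ℝ => PWAmalgam.pwNorm (f - J α)) (atTop ⊓ 𝓟 A) (𝓝 0)) ∧
      (∃ F : ℝ → ℂ, Continuous F ∧ (f : ℝ → ℂ) =ᵐ[volume] F ∧
        TendstoUniformly (fun (α : ℝ) (t : ℝ) => PWAmalgam.approximant (φ α) x (a α) t) F
          (atTop ⊓ 𝓟 A)) := by
  obtain ⟨T, hT'⟩ := hx
  have hT : ∀ n, T (lp.single 2 n 1) = expPi (x n) := fun n =>
    Lp.ext ((hT' n).trans (coeFn_expPi (x n)).symm)
  have hfs : Summable fun m => ‖cellPart f m‖ :=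
    summable_norm_of_tsum_enorm (by rw [← pwNorm_eq_tsum]; exact hf)
  refine ⟨fun α hα m => (hφ.interpolator α hα).existsUnique_interpolates hT f m, fun a ha => ?_⟩
  have hA : ∀ᶠ α in atTop ⊓ 𝓟 A, α ∈ A := mem_inf_of_right (mem_principal_self A)
  obtain ⟨C, hC⟩ := hφ.tail_bound
  have herr : ∀ α : ℝ, ∃ d : ℤ → L2Pi, α ∈ A → (Summable fun l => ‖d l‖) ∧
      ∑' l, ‖d l‖ ≤ errorConst T C * ∑' m, Real.sqrt (weightedSq (φ α) (cellPart f m)) ∧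
      ∀ t, HasSum (fun m => character m t * shiftSeries (φ α) x (a α m) t)
        (synth (fun l => cellPart f l - d l) t) := fun α => by
    by_cases hα : α ∈ A
    · obtain ⟨d, hd⟩ := (hφ.interpolator α hα).exists_error hT (hC α hα) hfs (ha α hα)
      exact ⟨d, fun _ => hd⟩
    -- Outside `A` any value serves; it only makes the choice total in `α`.
    · exact ⟨0, fun h => absurd h hα⟩
  choose d hd using herr
  have happ : ∀ α ∈ A, ∀ t,
      approximant (φ α) x (a α) t = synth (fun l => cellPart f l - d α l) t :=
    fun α hα t => ((hd α hα).2.2 t).tsum_eq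
  have hsub : ∀ α ∈ A, Summable fun l => ‖cellPart f l - d α l‖ := fun α hα =>
    Summable.of_nonneg_of_le (fun _ => norm_nonneg _) (fun l => norm_sub_le _ _)
      (hfs.add (hd α hα).1)
  have hlim : Tendsto (fun α => ∑' l, ‖d α l‖) (atTop ⊓ 𝓟 A) (𝓝 0) := by
    have h := (hφ.tendsto_tsum_sqrt_weightedSq hfs).const_mul (errorConst T C)
    rw [mul_zero] at h
    refine tendsto_of_tendsto_of_tendsto_of_le_of_le' tendsto_const_nhds h
      (Eventually.of_forall fun α => tsum_nonneg fun _ => norm_nonneg _) ?_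
    filter_upwards [hA] with α hα
    exact (hd α hα).2.1
  refine ⟨fun α hα t => ⟨fun m =>
    ((hφ.interpolator α hα).hasSum_shiftSeries hT (a α m) t).summable,
    ((hd α hα).2.2 t).summable⟩, ?_, ?_⟩
  · have hJ : ∀ α : ℝ, ∃ J : L2R, α ∈ A →
        (J : ℝ → ℂ) =ᵐ[volume] approximant (φ α) x (a α) ∧
          ∀ l, cellPart J l = cellPart f l - d α l := fun α => by
      by_cases hα : α ∈ A
      · obtain ⟨J, hJ, hJc⟩ := exists_cellPart_eq (hsub α hα)
        exact ⟨J, fun _ => ⟨hJ.trans (Eventually.of_forall fun t => (happ α hα t).symm), hJc⟩⟩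
      · exact ⟨0, fun h => absurd h hα⟩
    choose J hJ using hJ
    have hpw : ∀ α ∈ A, pwNorm (f - J α) = ENNReal.ofReal (∑' l, ‖d α l‖) := fun α hα => by
      rw [pwNorm_eq_tsum, ← tsum_enorm_eq_ofReal (hd α hα).1]
      refine tsum_congr fun l => ?_
      rw [cellPart_sub, (hJ α hα).2, sub_sub_cancel]
    refine ⟨J, fun α hα => (hJ α hα).1, fun α hα => ?_, ?_, ?_⟩
    · rw [MemPW, pwNorm_eq_tsum]
      simp_rw [(hJ α hα).2]
      rw [tsum_enorm_eq_ofReal (hsub α hα)]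
      exact ENNReal.ofReal_lt_top
    · refine tendsto_of_tendsto_of_tendsto_of_le_of_le' tendsto_const_nhds hlim
        (Eventually.of_forall fun α => norm_nonneg _) ?_
      filter_upwards [hA] with α hα
      have h := enorm_le_pwNorm (f - J α)
      rw [hpw α hα, ← ofReal_norm] at h
      exact (ENNReal.ofReal_le_ofReal_iff (tsum_nonneg fun _ => norm_nonneg _)).1 h
    · have h := ENNReal.tendsto_ofReal hlim
      rw [ENNReal.ofReal_zero] at h
      refine h.congr' ?_
      filter_upwards [hA] with α hα
      exact (hpw α hα).symm
  · obtain ⟨g, hg, hgc⟩ := exists_cellPart_eq hfs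
    refine ⟨synth (cellPart f), continuous_synth hfs, ?_, ?_⟩
    · rwa [eq_of_cellPart_eq hgc] at hg
    · rw [Metric.tendstoUniformly_iff]
      intro ε hε
      filter_upwards [hA, hlim.eventually (gt_mem_nhds hε)] with α hα hαε t
      -- The pointwise error is the synthesis of `d α`, bounded uniformly in `t` by its amalgam
      -- norm.
      rw [happ α hα, synth_sub hfs (hd α hα).1, dist_eq_norm, sub_sub_cancel]
      exact (norm_synth_le (hd α hα).1 t).trans_lt hαε
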